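/- A signed graph $\Gamma=(G,\sigma)$ is a finite simple graph $G$ with a function $\sigma:E(G)\to\{-1,1\}$. Its adjacency matrix $A_\Gamma$ has the $(i,j)$ entry $\sigma(ij)$ if $ij\in E(G)$ and $0$ otherwise. If $\mu_1,\dots,\mu_n$ are the eigenvalues of $A_\Gamma$, with multiplicity, the Estrada index of $\Gamma$ is $EE(\Gamma)=\sum_{i=1}^n e^{\mu_i}$. A signed graph is unicyclic if it is connected and has as many edges as vertices. Switching $\Gamma$ at a vertex set $Z$ reverses the signs of all edges between $Z$ and its complement; two signed graphs are switching equivalent if a switching of the first is isomorphic, by a sign-preserving graph isomorphism, to the second. Let $\Gamma_n^{3+}$ be the signed graph on $n$ vertices that consists of a triangle and $n-3$ pendant vertices, all attached to the same vertex of the triangle, with all edges positive. **Theorem.** Let $\Gamma$ be a signed unicyclic graph on $n\ge 4$ vertices. Then $EE(\Gamma)\le EE(\Gamma_n^{3+})$, with equality if and only if $\Gamma$ is switching equivalent to $\Gamma_n^{3+}$. -/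

import Mathlib

/-- A signed graph on the vertex set `V`: a simple graph together with a sign, `1` or `-1`,
for each of its edges. -/
structure SignedGraph (V : Type*) where
  graph : SimpleGraph V
  sign : graph.edgeSet → ℤˣ

namespace SignedGraph

open Classical in
/-- The adjacency matrix: the entry at `(i, j)` is the sign of the edge `ij` if `i` and `j` are
adjacent, and `0` otherwise. -/
noncomputable def adjMatrix {V : Type*} (Γ : SignedGraph V) : Matrix V V ℝ :=
  fun i j => if h : Γ.graph.Adj i j then ((Γ.sign ⟨s(i, j), h⟩ : ℤ) : ℝ) else 0

theorem adjMatrix_isHermitian {V : Type*} (Γ : SignedGraph V) : Γ.adjMatrix.IsHermitian := by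
  ext i j
  simp only [Matrix.conjTranspose_apply, star_trivial, adjMatrix]
  by_cases h : Γ.graph.Adj i j
  · have e : (⟨s(j, i), h.symm⟩ : Γ.graph.edgeSet) = ⟨s(i, j), h⟩ := Subtype.ext Sym2.eq_swap
    rw [dif_pos h, dif_pos h.symm, e]
  · rw [dif_neg h, dif_neg (fun h' => h h'.symm)]

open Classical in
/-- The Estrada index: the sum of `exp μ` over the eigenvalues `μ` of the adjacency matrix,
counted with multiplicity. -/
noncomputable def estradaIndex {V : Type*} [Fintype V] (Γ : SignedGraph V) : ℝ :=
  ∑ i : V, Real.exp (Γ.adjMatrix_isHermitian.eigenvalues i)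

open Classical in
/-- Switching at `Z`: the signs of the edges between `Z` and its complement are reversed. -/
noncomputable def switch {V : Type*} (Γ : SignedGraph V) (Z : Set V) : SignedGraph V where
  graph := Γ.graph
  sign e := if ∃ u ∈ Z, ∃ v ∉ Z, (e : Sym2 V) = s(u, v) then -Γ.sign e else Γ.sign e

/-- Two signed graphs are isomorphic if some graph isomorphism preserves the signs of edges. -/
def Isomorphic {V W : Type*} (Γ : SignedGraph V) (Δ : SignedGraph W) : Prop :=
  ∃ f : Γ.graph ≃g Δ.graph, ∀ (i j : V) (h : Γ.graph.Adj i j),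
    Δ.sign ⟨s(f i, f j), f.map_adj_iff.2 h⟩ = Γ.sign ⟨s(i, j), h⟩

/-- Switching equivalence, with signed graphs considered up to isomorphism. -/
def SwitchingEquivalent {V W : Type*} (Γ : SignedGraph V) (Δ : SignedGraph W) : Prop :=
  ∃ Z : Set V, (Γ.switch Z).Isomorphic Δ

/-- A signed graph is unicyclic if it is connected and has as many edges as vertices. -/
def IsUnicyclic {V : Type*} (Γ : SignedGraph V) : Prop :=
  Γ.graph.Connected ∧ Nat.card Γ.graph.edgeSet = Nat.card V

/-- The triangle on the vertices `0, 1, 2` with the pendant vertices `3, …, n - 1` attached at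
the vertex `0`; all edges are positive (so the triangle is positive). -/
def positiveTriangleWithPendants (n : ℕ) : SignedGraph (Fin n) where
  graph := SimpleGraph.fromRel fun i j => i.val = 0 ∨ (i.val = 1 ∧ j.val = 2)
  sign _ := 1

end SignedGraph

/-! The Estrada index is the sum over `k` of the `k`-th spectral moment divided by `k!`, where the
`k`-th moment is the trace of the `k`-th power of the adjacency matrix. If all moments of one matrix
are at most those of another, the indices compare, and one strict moment gives a strict inequality.

Signs only decrease moments, since the adjacency matrix of a signed graph is bounded entrywise by
that of its underlying graph `G`. It remains to maximize over unsigned connected graphs with as many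
edges as vertices. Let `u` and `v` be nonadjacent with a common neighbour, each having a neighbour
that the other lacks. Conjugation by an orthogonal involution replaces columns `u`, `v` by their
normalized sum and difference. In this basis, moving the private neighbours of `v` to `u` replaces
every entry by its absolute value (`abs_conj_eq`), so no moment decreases, and the fourth strictly
increases (`expTrace_lt_moveNeighbors`). The move keeps the graph connected and preserves the number
of edges, so in a maximizer such neighbourhoods are nested.

Nestedness leaves two shapes (`LocallyNested.triangle_or_quadrangle`): a triangle with pendant
vertices, or a quadrangle with pendant vertices at two adjacent vertices. Their nonzero powers have
the traces of powers of a 6 by 6 quotient matrix, whose characteristic polynomial gives a recursion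
for the moments. Comparing recursions shows that the triangle with all pendants at one vertex has
the largest moments; only the bare quadrangle escapes this and is compared numerically.

In the equality case the underlying graph is this extremal graph, and the third moment forces a
positive triangle. Switching at the vertices joined negatively to the centre then makes all edges
positive. -/

open Matrix

/-! ### Moments of symmetric real matrices -/

section Moments

variable {V : Type*} [Fintype V] [DecidableEq V]

/-- The trace of a power of a Hermitian matrix is the power sum of its eigenvalues. -/
theorem Matrix.IsHermitian.trace_pow_eq_sum {A : Matrix V V ℝ} (hA : A.IsHermitian) (k : ℕ) :
    (A ^ k).trace = ∑ i, hA.eigenvalues i ^ k := by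
  have h : A ^ k = Unitary.conjStarAlgAut ℝ _ hA.eigenvectorUnitary
      (diagonal hA.eigenvalues ^ k) := by
    rw [map_pow]
    congr 1
    exact hA.spectral_theorem
  rw [h, Unitary.conjStarAlgAut_apply, trace_mul_cycle, Unitary.coe_star_mul_self, one_mul,
    diagonal_pow, trace_diagonal]
  simp

theorem Matrix.IsHermitian.hasSum_exp_eigenvalues {A : Matrix V V ℝ} (hA : A.IsHermitian) :
    HasSum (fun k : ℕ => (A ^ k).trace / (k.factorial : ℝ))
      (∑ i, Real.exp (hA.eigenvalues i)) := by
  have h : ∀ i ∈ (Finset.univ : Finset V), HasSum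
      (fun k : ℕ => hA.eigenvalues i ^ k / (k.factorial : ℝ)) (Real.exp (hA.eigenvalues i)) := by
    intro i _
    rw [Real.exp_eq_exp_ℝ]
    exact NormedSpace.expSeries_div_hasSum_exp _
  refine (hasSum_sum h).congr_fun fun k => ?_
  rw [hA.trace_pow_eq_sum, Finset.sum_div]

/-- The sum of `exp μ` over the eigenvalues `μ`, as a power series in the moments. -/
noncomputable def Matrix.expTrace (A : Matrix V V ℝ) : ℝ :=
  ∑' k : ℕ, (A ^ k).trace / (k.factorial : ℝ)

theorem Matrix.IsHermitian.expTrace_eq {A : Matrix V V ℝ} (hA : A.IsHermitian) :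
    A.expTrace = ∑ i, Real.exp (hA.eigenvalues i) :=
  hA.hasSum_exp_eigenvalues.tsum_eq

theorem Matrix.IsHermitian.hasSum_expTrace {A : Matrix V V ℝ} (hA : A.IsHermitian) :
    HasSum (fun k : ℕ => (A ^ k).trace / (k.factorial : ℝ)) A.expTrace := by
  rw [hA.expTrace_eq]
  exact hA.hasSum_exp_eigenvalues

variable {W : Type*} [Fintype W] [DecidableEq W]

theorem Matrix.expTrace_congr {A : Matrix V V ℝ} {B : Matrix W W ℝ}
    (h : ∀ k, (A ^ k).trace = (B ^ k).trace) : A.expTrace = B.expTrace := by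
  simp only [expTrace, h]

theorem Matrix.expTrace_le {A : Matrix V V ℝ} {B : Matrix W W ℝ} (hA : A.IsHermitian)
    (hB : B.IsHermitian) (h : ∀ k, (A ^ k).trace ≤ (B ^ k).trace) : A.expTrace ≤ B.expTrace := by
  refine hasSum_le (fun k => ?_) hA.hasSum_expTrace hB.hasSum_expTrace
  exact div_le_div_of_nonneg_right (h k) (by positivity)

theorem Matrix.expTrace_lt {A : Matrix V V ℝ} {B : Matrix W W ℝ} (hA : A.IsHermitian)
    (hB : B.IsHermitian) (h : ∀ k, (A ^ k).trace ≤ (B ^ k).trace) {j : ℕ}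
    (hj : (A ^ j).trace < (B ^ j).trace) : A.expTrace < B.expTrace := by
  refine hasSum_lt (i := j) (fun k => ?_) ?_ hA.hasSum_expTrace hB.hasSum_expTrace
  · exact div_le_div_of_nonneg_right (h k) (by positivity)
  · exact div_lt_div_of_pos_right hj (by positivity)

theorem Matrix.abs_pow_le {M N : Matrix V V ℝ} (h : ∀ i j, |M i j| ≤ N i j) (k : ℕ) :
    ∀ i j, |(M ^ k) i j| ≤ (N ^ k) i j := by
  induction k with
  | zero =>
    intro i j
    simp only [pow_zero, one_apply]
    split_ifs <;> simp
  | succ k ih =>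
    intro i j
    rw [pow_succ, pow_succ, mul_apply, mul_apply]
    refine (Finset.abs_sum_le_sum_abs _ _).trans (Finset.sum_le_sum fun l _ => ?_)
    rw [abs_mul]
    exact mul_le_mul (ih i l) (h l j) (abs_nonneg _) ((abs_nonneg _).trans (ih i l))

theorem Matrix.pow_entry_nonneg {N : Matrix V V ℝ} (h : ∀ i j, 0 ≤ N i j) (k : ℕ) (i j : V) :
    0 ≤ (N ^ k) i j :=
  (abs_nonneg _).trans (abs_pow_le (M := N) (N := N) (fun i j => (abs_of_nonneg (h i j)).le) k i j)

theorem Matrix.trace_pow_nonneg {N : Matrix V V ℝ} (h : ∀ i j, 0 ≤ N i j) (k : ℕ) :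
    0 ≤ (N ^ k).trace :=
  Finset.sum_nonneg fun i _ => pow_entry_nonneg h k i i

theorem Matrix.trace_pow_le {M N : Matrix V V ℝ} (h : ∀ i j, |M i j| ≤ N i j) (k : ℕ) :
    (M ^ k).trace ≤ (N ^ k).trace :=
  Finset.sum_le_sum fun i _ => (le_abs_self _).trans (abs_pow_le h k i i)

/-- Domination of entries makes the fourth moment strictly larger if some entry of the square
becomes strictly larger in absolute value. -/
theorem Matrix.trace_pow_four_lt {M N : Matrix V V ℝ} (hM : M.IsHermitian) (hN : N.IsHermitian)
    (h : ∀ i j, |M i j| ≤ N i j) {u v : V} (huv : |(M ^ 2) u v| < (N ^ 2) u v) :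
    (M ^ 4).trace < (N ^ 4).trace := by
  have key : ∀ {L : Matrix V V ℝ}, L.IsHermitian →
      (L ^ 4).trace = ∑ i, ∑ j, (L ^ 2) i j ^ 2 := by
    intro L hL
    have e : L ^ 4 = L ^ 2 * L ^ 2 := by rw [← pow_add]
    rw [e]
    simp only [trace, diag, mul_apply]
    refine Finset.sum_congr rfl fun i _ => Finset.sum_congr rfl fun j _ => ?_
    have := (hL.pow 2).apply i j
    rw [star_trivial] at this
    rw [this]
    exact (pow_two _).symm
  rw [key hM, key hN]
  have hle : ∀ i j, (M ^ 2) i j ^ 2 ≤ (N ^ 2) i j ^ 2 := fun i j =>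
    sq_le_sq' (abs_le.1 (abs_pow_le h 2 i j)).1 (abs_le.1 (abs_pow_le h 2 i j)).2
  refine Finset.sum_lt_sum (fun i _ => Finset.sum_le_sum fun j _ => hle i j)
    ⟨u, Finset.mem_univ _, Finset.sum_lt_sum (fun j _ => hle u j) ⟨v, Finset.mem_univ _, ?_⟩⟩
  exact sq_lt_sq' (abs_lt.1 huv).1 (abs_lt.1 huv).2

theorem Matrix.trace_conj_pow {A H : Matrix V V ℝ} (hH : H * H = 1) (k : ℕ) :
    ((H * A * H) ^ k).trace = (A ^ k).trace := by
  have h : ∀ k, (H * A * H) ^ k = H * A ^ k * H := by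
    intro k
    induction k with
    | zero => simp [hH]
    | succ k ih =>
      rw [pow_succ, ih, pow_succ]
      calc H * A ^ k * H * (H * A * H) = H * A ^ k * (H * H) * A * H := by
            simp only [Matrix.mul_assoc]
        _ = _ := by rw [hH]; simp only [Matrix.mul_assoc, Matrix.one_mul]
  rw [h, trace_mul_comm, ← Matrix.mul_assoc, hH, Matrix.one_mul]

/-- If the rows of `A` depend only on the class of their index, the positive moments of `A` are
those of the quotient matrix. -/
theorem Matrix.trace_pow_eq_quotient (A : Matrix V V ℝ) (κ : V → W) (C : Matrix W W ℝ)
    (h : ∀ x y, A x y = C (κ x) (κ y)) (k : ℕ) :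
    (A ^ (k + 1)).trace = ((Matrix.of fun i j =>
      C i j * ((Finset.univ.filter fun y => κ y = j).card : ℝ)) ^ (k + 1)).trace := by
  set R : Matrix W W ℝ := Matrix.of fun i j =>
      C i j * ((Finset.univ.filter fun y => κ y = j).card : ℝ) with hR
  let B : Matrix V W ℝ := Matrix.of fun x j => if κ x = j then 1 else 0
  let D : Matrix W V ℝ := Matrix.of fun i y => C i (κ y)
  -- `A = B * D` factors through the classes and `R = D * B`, so nonzero powers have equal traces.
  -- The power zero is excluded: there the traces count `V` and `W`.
  have hA : A = B * D := by
    ext x y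
    simp [B, D, mul_apply, h]
  have hD : R = D * B := by
    ext i j
    have : ∀ y, C i (κ y) * (if κ y = j then (1 : ℝ) else 0)
        = if κ y = j then C i j else 0 := by
      intro y
      split_ifs with e
      · rw [e, mul_one]
      · rw [mul_zero]
    simp only [hR, B, D, mul_apply, of_apply, this]
    rw [← Finset.sum_filter, Finset.sum_const, nsmul_eq_mul, mul_comm]
  have hp : ∀ k, A ^ (k + 1) = B * R ^ k * D := by
    intro k
    induction k with
    | zero => simp [hA]
    | succ k ih =>
      rw [pow_succ A, ih, pow_succ R, hA]
      nth_rewrite 3 [hD]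
      simp only [Matrix.mul_assoc]
  rw [hp, trace_mul_comm, ← Matrix.mul_assoc, ← hD, pow_succ']

end Moments

/-! ### Quotient matrices of the candidate graphs -/

/-- The quotient matrix of the triangle with `p`, `q` and `r` pendant vertices at its vertices. -/
def triangleQuotient (p q r : ℝ) : Matrix (Fin 6) (Fin 6) ℝ :=
  !![0, 1, 1, p, 0, 0;
     1, 0, 1, 0, q, 0;
     1, 1, 0, 0, 0, r;
     1, 0, 0, 0, 0, 0;
     0, 1, 0, 0, 0, 0;
     0, 0, 1, 0, 0, 0]

/-- The quotient matrix of the quadrangle with `p` and `q` pendant vertices at two adjacent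
vertices. -/
def quadrangleQuotient (p q : ℝ) : Matrix (Fin 6) (Fin 6) ℝ :=
  !![0, 1, 1, p, 0, 0;
     1, 0, 0, 0, q, 1;
     1, 0, 0, 0, 0, 1;
     1, 0, 0, 0, 0, 0;
     0, 1, 0, 0, 0, 0;
     0, 1, 1, 0, 0, 0]

theorem triangleQuotient_sq (p q r : ℝ) : triangleQuotient p q r ^ 2 =
    !![2 + p, 1, 1, 0, q, r;
       1, 2 + q, 1, p, 0, r;
       1, 1, 2 + r, p, q, 0;
       0, 1, 1, p, 0, 0;
       1, 0, 1, 0, q, 0;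
       1, 1, 0, 0, 0, r] := by
  rw [sq]
  ext i j
  fin_cases i <;> fin_cases j <;>
    simp [triangleQuotient, mul_apply, Fin.sum_univ_six] <;> ring

theorem triangleQuotient_cube (p q r : ℝ) : triangleQuotient p q r ^ 3 =
    !![2, 3 + p + q, 3 + p + r, p * (2 + p), q, r;
       3 + p + q, 2, 3 + q + r, p, q * (2 + q), r;
       3 + p + r, 3 + q + r, 2, p, q, r * (2 + r);
       2 + p, 1, 1, 0, q, r;
       1, 2 + q, 1, p, 0, r;
       1, 1, 2 + r, p, q, 0] := by
  rw [pow_succ, triangleQuotient_sq]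
  ext i j
  fin_cases i <;> fin_cases j <;>
    simp [triangleQuotient, mul_apply, Fin.sum_univ_six] <;> ring

theorem quadrangleQuotient_sq (p q : ℝ) : quadrangleQuotient p q ^ 2 =
    !![2 + p, 0, 0, 0, q, 2;
       0, 2 + q, 2, p, 0, 0;
       0, 2, 2, p, 0, 0;
       0, 1, 1, p, 0, 0;
       1, 0, 0, 0, q, 1;
       2, 0, 0, 0, q, 2] := by
  rw [sq]
  ext i j
  fin_cases i <;> fin_cases j <;>
    simp [quadrangleQuotient, mul_apply, Fin.sum_univ_six] <;> ring

theorem quadrangleQuotient_cube (p q : ℝ) : quadrangleQuotient p q ^ 3 =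
    !![0, 4 + p + q, 4 + p, p * (2 + p), 0, 0;
       4 + p + q, 0, 0, 0, q * (2 + q), 4 + q;
       4 + p, 0, 0, 0, 2 * q, 4;
       2 + p, 0, 0, 0, q, 2;
       0, 2 + q, 2, p, 0, 0;
       0, 4 + q, 4, 2 * p, 0, 0] := by
  rw [pow_succ, quadrangleQuotient_sq]
  ext i j
  fin_cases i <;> fin_cases j <;>
    simp [quadrangleQuotient, mul_apply, Fin.sum_univ_six] <;> ring

set_option maxHeartbeats 1000000 in
-- This is Cayley–Hamilton with the characteristic polynomial written out. For fixed `p + q + r`,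
-- only the coefficients of the square and of the identity depend on how the pendants are
-- distributed.
theorem triangleQuotient_pow_six (p q r : ℝ) : triangleQuotient p q r ^ 6 =
    (p + q + r + 3) • triangleQuotient p q r ^ 4 + (2 : ℝ) • triangleQuotient p q r ^ 3
      - (p * q + p * r + q * r + (p + q + r)) • triangleQuotient p q r ^ 2
      + (p * q * r) • (1 : Matrix (Fin 6) (Fin 6) ℝ) := by
  have h6 : triangleQuotient p q r ^ 6 =
      triangleQuotient p q r ^ 3 * triangleQuotient p q r ^ 3 := by
    rw [← pow_add]
  have h4 : triangleQuotient p q r ^ 4 =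
      triangleQuotient p q r ^ 2 * triangleQuotient p q r ^ 2 := by
    rw [← pow_add]
  rw [h6, h4, triangleQuotient_cube, triangleQuotient_sq]
  ext i j
  fin_cases i <;> fin_cases j <;>
    simp [mul_apply, Fin.sum_univ_six, one_apply] <;> ring

set_option maxHeartbeats 1000000 in
theorem quadrangleQuotient_pow_six (p q : ℝ) : quadrangleQuotient p q ^ 6 =
    (p + q + 4) • quadrangleQuotient p q ^ 4
      - (2 * (p + q) + p * q) • quadrangleQuotient p q ^ 2
      + (p * q) • (1 : Matrix (Fin 6) (Fin 6) ℝ) := by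
  have h6 : quadrangleQuotient p q ^ 6 =
      quadrangleQuotient p q ^ 3 * quadrangleQuotient p q ^ 3 := by
    rw [← pow_add]
  have h4 : quadrangleQuotient p q ^ 4 =
      quadrangleQuotient p q ^ 2 * quadrangleQuotient p q ^ 2 := by
    rw [← pow_add]
  rw [h6, h4, quadrangleQuotient_cube, quadrangleQuotient_sq]
  ext i j
  fin_cases i <;> fin_cases j <;>
    simp [mul_apply, Fin.sum_univ_six, one_apply] <;> ring

/-- The moments of `triangleQuotient`. -/
noncomputable def triangleMoment (p q r : ℝ) (k : ℕ) : ℝ := (triangleQuotient p q r ^ k).trace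

/-- The moments of `quadrangleQuotient`. -/
noncomputable def quadrangleMoment (p q : ℝ) (k : ℕ) : ℝ := (quadrangleQuotient p q ^ k).trace

theorem triangleMoment_add_six (p q r : ℝ) (k : ℕ) : triangleMoment p q r (k + 6) =
    (p + q + r + 3) * triangleMoment p q r (k + 4) + 2 * triangleMoment p q r (k + 3)
      - (p * q + p * r + q * r + (p + q + r)) * triangleMoment p q r (k + 2)
      + p * q * r * triangleMoment p q r k := by
  simp only [triangleMoment]
  rw [pow_add, triangleQuotient_pow_six]
  simp only [mul_add, mul_sub, mul_smul_comm, trace_add, trace_sub, trace_smul, smul_eq_mul,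
    ← pow_add, mul_one]

theorem quadrangleMoment_add_six (p q : ℝ) (k : ℕ) : quadrangleMoment p q (k + 6) =
    (p + q + 4) * quadrangleMoment p q (k + 4)
      - (2 * (p + q) + p * q) * quadrangleMoment p q (k + 2)
      + p * q * quadrangleMoment p q k := by
  simp only [quadrangleMoment]
  rw [pow_add, quadrangleQuotient_pow_six]
  simp only [mul_add, mul_sub, mul_smul_comm, trace_add, trace_sub, trace_smul, smul_eq_mul,
    ← pow_add, mul_one]

theorem triangleMoment_zero (p q r : ℝ) : triangleMoment p q r 0 = 6 := by
  simp [triangleMoment]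

theorem triangleMoment_one (p q r : ℝ) : triangleMoment p q r 1 = 0 := by
  simp [triangleMoment, triangleQuotient, trace, Fin.sum_univ_six]

theorem triangleMoment_two (p q r : ℝ) : triangleMoment p q r 2 = 2 * (p + q + r + 3) := by
  simp [triangleMoment, triangleQuotient_sq, trace, Fin.sum_univ_six]
  ring

theorem triangleMoment_three (p q r : ℝ) : triangleMoment p q r 3 = 6 := by
  simp [triangleMoment, triangleQuotient_cube, trace, Fin.sum_univ_six]
  norm_num

theorem triangleMoment_four (p q r : ℝ) : triangleMoment p q r 4 =
    2 * (p + q + r + 3) ^ 2 - 4 * (p + q + r) - 4 * (p * q + p * r + q * r) := by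
  have h : triangleQuotient p q r ^ 4 =
      triangleQuotient p q r ^ 2 * triangleQuotient p q r ^ 2 := by
    rw [← pow_add]
  rw [triangleMoment, h, triangleQuotient_sq]
  simp [trace, Fin.sum_univ_six]
  ring

theorem triangleMoment_five (p q r : ℝ) : triangleMoment p q r 5 = 10 * (p + q + r + 3) := by
  have h : triangleQuotient p q r ^ 5 =
      triangleQuotient p q r ^ 2 * triangleQuotient p q r ^ 3 := by
    rw [← pow_add]
  rw [triangleMoment, h, triangleQuotient_sq, triangleQuotient_cube]
  simp [trace, Fin.sum_univ_six]
  ring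

theorem quadrangleMoment_zero (p q : ℝ) : quadrangleMoment p q 0 = 6 := by
  simp [quadrangleMoment]

theorem quadrangleMoment_one (p q : ℝ) : quadrangleMoment p q 1 = 0 := by
  simp [quadrangleMoment, quadrangleQuotient, trace, Fin.sum_univ_six]

theorem quadrangleMoment_two (p q : ℝ) : quadrangleMoment p q 2 = 2 * (p + q + 4) := by
  simp [quadrangleMoment, quadrangleQuotient_sq, trace, Fin.sum_univ_six]
  ring

theorem quadrangleMoment_three (p q : ℝ) : quadrangleMoment p q 3 = 0 := by
  simp [quadrangleMoment, quadrangleQuotient_cube, trace, Fin.sum_univ_six]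

theorem quadrangleMoment_four (p q : ℝ) : quadrangleMoment p q 4 =
    2 * (p + q + 4) ^ 2 - 8 * (p + q) - 4 * (p * q) := by
  have h : quadrangleQuotient p q ^ 4 =
      quadrangleQuotient p q ^ 2 * quadrangleQuotient p q ^ 2 := by
    rw [← pow_add]
  rw [quadrangleMoment, h, quadrangleQuotient_sq]
  simp [trace, Fin.sum_univ_six]
  ring

theorem quadrangleMoment_five (p q : ℝ) : quadrangleMoment p q 5 = 0 := by
  have h : quadrangleQuotient p q ^ 5 =
      quadrangleQuotient p q ^ 2 * quadrangleQuotient p q ^ 3 := by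
    rw [← pow_add]
  rw [quadrangleMoment, h, quadrangleQuotient_sq, quadrangleQuotient_cube]
  simp [trace, Fin.sum_univ_six]

theorem triangleQuotient_nonneg {p q r : ℝ} (hp : 0 ≤ p) (hq : 0 ≤ q) (hr : 0 ≤ r)
    (i j : Fin 6) : 0 ≤ triangleQuotient p q r i j := by
  fin_cases i <;> fin_cases j <;> simp [triangleQuotient, hp, hq, hr]

theorem quadrangleQuotient_nonneg {p q : ℝ} (hp : 0 ≤ p) (hq : 0 ≤ q)
    (i j : Fin 6) : 0 ≤ quadrangleQuotient p q i j := by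
  fin_cases i <;> fin_cases j <;> simp [quadrangleQuotient, hp, hq]

theorem triangleMoment_nonneg {p q r : ℝ} (hp : 0 ≤ p) (hq : 0 ≤ q) (hr : 0 ≤ r) (k : ℕ) :
    0 ≤ triangleMoment p q r k :=
  trace_pow_nonneg (triangleQuotient_nonneg hp hq hr) k

theorem quadrangleMoment_nonneg {p q : ℝ} (hp : 0 ≤ p) (hq : 0 ≤ q) (k : ℕ) :
    0 ≤ quadrangleMoment p q k :=
  trace_pow_nonneg (quadrangleQuotient_nonneg hp hq) k

/-- If the square of a nonnegative matrix dominates `c` on the diagonal, then the moments grow at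
least by the factor `c` in two steps. -/
theorem Matrix.mul_trace_pow_le {V : Type*} [Fintype V] [DecidableEq V] {N : Matrix V V ℝ}
    (h : ∀ i j, 0 ≤ N i j) {c : ℝ} (hc : ∀ i, c ≤ (N ^ 2) i i) (k : ℕ) :
    c * (N ^ k).trace ≤ (N ^ (k + 2)).trace := by
  rw [pow_add]
  simp only [trace, diag, mul_apply, Finset.mul_sum]
  refine Finset.sum_le_sum fun i _ => ?_
  refine le_trans ?_ (Finset.single_le_sum
    (fun j _ => mul_nonneg (pow_entry_nonneg h k i j) (pow_entry_nonneg h 2 j i))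
    (Finset.mem_univ i))
  rw [mul_comm]
  exact mul_le_mul_of_nonneg_left (hc i) (pow_entry_nonneg h k i i)

theorem mul_triangleMoment_le {p q r c : ℝ} (hc : 0 ≤ c) (hp : c ≤ p) (hq : c ≤ q) (hr : c ≤ r)
    (k : ℕ) : c * triangleMoment p q r k ≤ triangleMoment p q r (k + 2) := by
  refine mul_trace_pow_le
    (triangleQuotient_nonneg (hc.trans hp) (hc.trans hq) (hc.trans hr)) (fun i => ?_) k
  rw [triangleQuotient_sq]
  fin_cases i <;> simp <;> linarith

/-- The moments of a linear recursion with dominating first coefficient stay nonnegative. -/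
theorem nonneg_of_recursion {δ : ℕ → ℝ} {c d : ℝ} (hcd : d + 1 ≤ c) (hd : 0 ≤ d)
    (h2 : 0 ≤ δ 2) (h3 : 0 ≤ δ 3) (h4 : δ 2 ≤ δ 4) (h5 : δ 3 ≤ δ 5)
    (h : ∀ k, (∀ j, 2 ≤ j → j < k + 6 → 0 ≤ δ j) →
      c * δ (k + 4) - d * δ (k + 2) ≤ δ (k + 6)) (k : ℕ) :
    0 ≤ δ (k + 2) := by
  -- Nonnegativity alone does not propagate through the negative term. Growth in steps of two does:
  -- `c - 1 ≥ d` gives `δ (i + 6) - δ (i + 4) ≥ d * (δ (i + 4) - δ (i + 2)) ≥ 0`.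
  have key : ∀ k, ∀ j ≤ k, 0 ≤ δ (j + 2) ∧ δ (j + 2) ≤ δ (j + 4) := by
    intro k
    induction k with
    | zero =>
      intro j hj
      obtain rfl : j = 0 := by omega
      exact ⟨h2, h4⟩
    | succ k ih =>
      intro j hj
      rcases Nat.lt_or_ge j 2 with h1 | h1
      · interval_cases j
        · exact ⟨h2, h4⟩
        · exact ⟨h3, h5⟩
      · obtain ⟨i, rfl⟩ := Nat.exists_eq_add_of_le' h1
        obtain ⟨a0, a1⟩ := ih i (by omega)
        have hh := h i (fun j hj hj' => by
          rcases Nat.lt_or_ge j (k + 3) with hk | hk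
          · obtain ⟨m, rfl⟩ := Nat.exists_eq_add_of_le' hj
            exact (ih m (by omega)).1
          · obtain ⟨m, rfl⟩ : ∃ m, j = m + 4 := ⟨j - 4, by omega⟩
            obtain ⟨b0, b1⟩ := ih m (by omega)
            exact b0.trans b1)
        have e1 : i + 2 + 2 = i + 4 := rfl
        have e2 : i + 2 + 4 = i + 6 := rfl
        rw [e1, e2]
        have hn : 0 ≤ δ (i + 4) := a0.trans a1
        refine ⟨hn, ?_⟩
        nlinarith [mul_le_mul_of_nonneg_left a1 hd, mul_nonneg (sub_nonneg.2 hcd) hn]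
  exact (key k k le_rfl).1

/-- Subtracting the two recursions leaves the extra terms `(p * q + p * r + q * r) * m (k + 2) - p *
q * r * m k`, where `m` is the moment for `p`, `q`, `r`. They are nonnegative because the least of
`p`, `q`, `r` times `m k` is at most `m (k + 2)`. -/
theorem triangleMoment_le {p q r : ℝ} (hp : 0 ≤ p) (hq : 0 ≤ q) (hr : 0 ≤ r) (k : ℕ) :
    triangleMoment p q r k ≤ triangleMoment (p + q + r) 0 0 k := by
  have hg : ∀ k, p * q * r * triangleMoment p q r k ≤
      (p * q + p * r + q * r) * triangleMoment p q r (k + 2) := by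
    intro k
    have m0 := triangleMoment_nonneg hp hq hr k
    have m2 := triangleMoment_nonneg hp hq hr (k + 2)
    have a1 : 0 ≤ p * q := mul_nonneg hp hq
    have a2 : 0 ≤ p * r := mul_nonneg hp hr
    have a3 : 0 ≤ q * r := mul_nonneg hq hr
    rcases le_total p q with h1 | h1 <;> rcases le_total q r with h2 | h2 <;>
      rcases le_total p r with h3 | h3
    all_goals
      first
      | have := mul_triangleMoment_le hp le_rfl (by linarith) (by linarith) k (q := q) (r := r)
        nlinarith [mul_le_mul_of_nonneg_left this a3, mul_nonneg a1 m2, mul_nonneg a2 m2]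
      | have := mul_triangleMoment_le hq (by linarith) le_rfl (by linarith) k (p := p) (r := r)
        nlinarith [mul_le_mul_of_nonneg_left this a2, mul_nonneg a1 m2, mul_nonneg a3 m2]
      | have := mul_triangleMoment_le hr (by linarith) (by linarith) le_rfl k (p := p) (q := q)
        nlinarith [mul_le_mul_of_nonneg_left this a1, mul_nonneg a2 m2, mul_nonneg a3 m2]
  rcases Nat.lt_or_ge k 2 with h | h
  · interval_cases k
    · simp [triangleMoment_zero]
    · simp [triangleMoment_one]
  obtain ⟨k, rfl⟩ := Nat.exists_eq_add_of_le' h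
  rw [← sub_nonneg]
  refine nonneg_of_recursion
    (δ := fun k => triangleMoment (p + q + r) 0 0 k - triangleMoment p q r k)
    (c := p + q + r + 3) (d := p + q + r) (by linarith) (by positivity) ?_ ?_ ?_ ?_ ?_ k
  · simp [triangleMoment_two]
  · simp [triangleMoment_three]
  · simp only [triangleMoment_two, triangleMoment_four]
    nlinarith [mul_nonneg hp hq, mul_nonneg hp hr, mul_nonneg hq hr]
  · simp [triangleMoment_three, triangleMoment_five]
  · intro k hk
    have h3 := hk (k + 3) (by omega) (by omega)
    have := hg k
    simp only [triangleMoment_add_six] at *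
    nlinarith

theorem triangleMoment_four_lt {p q r : ℝ} (h : 0 < p * q + p * r + q * r) :
    triangleMoment p q r 4 < triangleMoment (p + q + r) 0 0 4 := by
  simp only [triangleMoment_four]
  nlinarith

/-- The leading coefficients of the two recursions agree. What remains is twice a triangle moment,
`(p + q - 1) * m (k + 2)` and `p * q * (m (k + 2) - m k)`, with `m` the quadrangle moment; the
hypotheses make each nonnegative. Without pendants the claim fails at the fourth moment, 32 against
28. -/
theorem quadrangleMoment_le {p q : ℝ} (hp : 0 ≤ p) (hq : 0 ≤ q) (h : 1 ≤ p + q)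
    (hpq : p * q = 0 ∨ (1 ≤ p ∧ 1 ≤ q)) (k : ℕ) :
    quadrangleMoment p q k ≤ triangleMoment (p + q + 1) 0 0 k := by
  have hg : ∀ k, p * q * quadrangleMoment p q k ≤ p * q * quadrangleMoment p q (k + 2) := by
    intro k
    rcases hpq with h0 | ⟨h1, h2⟩
    · simp [h0]
    · refine mul_le_mul_of_nonneg_left ?_ (mul_nonneg hp hq)
      have := mul_trace_pow_le (quadrangleQuotient_nonneg hp hq) (c := 1) (fun i => by
        rw [quadrangleQuotient_sq]
        fin_cases i <;> simp <;> linarith) k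
      simpa [quadrangleMoment] using this
  rcases Nat.lt_or_ge k 2 with h' | h'
  · interval_cases k
    · simp [triangleMoment_zero, quadrangleMoment_zero]
    · simp [triangleMoment_one, quadrangleMoment_one]
  obtain ⟨k, rfl⟩ := Nat.exists_eq_add_of_le' h'
  rw [← sub_nonneg]
  refine nonneg_of_recursion
    (δ := fun k => triangleMoment (p + q + 1) 0 0 k - quadrangleMoment p q k)
    (c := p + q + 4) (d := p + q + 1) (by linarith) (by positivity) ?_ ?_ ?_ ?_ ?_ k
  · simp [triangleMoment_two, quadrangleMoment_two]
    linarith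
  · simp [triangleMoment_three, quadrangleMoment_three]
  · simp only [triangleMoment_two, triangleMoment_four, quadrangleMoment_two,
      quadrangleMoment_four]
    nlinarith [mul_nonneg hp hq]
  · simp [triangleMoment_three, triangleMoment_five, quadrangleMoment_three,
      quadrangleMoment_five]
    linarith
  · intro k hk
    have h3 := triangleMoment_nonneg (p := p + q + 1) (q := 0) (r := 0)
      (by linarith) le_rfl le_rfl (k + 3)
    have h2 := mul_nonneg (sub_nonneg.2 h) (quadrangleMoment_nonneg hp hq (k + 2))
    have := hg k
    simp only [triangleMoment_add_six, quadrangleMoment_add_six] at *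
    nlinarith

theorem quadrangleMoment_three_lt (p q : ℝ) :
    quadrangleMoment p q 3 < triangleMoment (p + q + 1) 0 0 3 := by
  simp [quadrangleMoment_three, triangleMoment_three]

/-- The nonzero eigenvalues are 2 and -2; the zero eigenvalues contribute only to the power zero. -/
theorem quadrangleMoment_zero_zero (k : ℕ) :
    quadrangleMoment 0 0 (k + 1) = 2 ^ (k + 1) + (-2) ^ (k + 1) := by
  induction k using Nat.strong_induction_on with
  | _ k ih =>
    rcases Nat.lt_or_ge k 5 with h | h
    · interval_cases k
      · simp [quadrangleMoment_one]
      · norm_num [quadrangleMoment_two]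
      · norm_num [quadrangleMoment_three]
      · norm_num [quadrangleMoment_four]
      · norm_num [quadrangleMoment_five]
    · obtain ⟨k, rfl⟩ := Nat.exists_eq_add_of_le' h
      have h1 := ih (k + 3) (by omega)
      rw [show k + 5 + 1 = k + 6 from rfl, quadrangleMoment_add_six, h1]
      ring

/-- The quadrangle has a smaller Estrada index than the triangle with one pendant vertex. -/
theorem expTrace_lt_of_quadrangle {V W : Type*} [Fintype V] [DecidableEq V] [Fintype W]
    [DecidableEq W] {A : Matrix V V ℝ} {B : Matrix W W ℝ} (hA : A.IsHermitian)
    (hB : B.IsHermitian) (hV : Fintype.card V = 4) (hW : Fintype.card W = 4)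
    (hAk : ∀ k, (A ^ (k + 1)).trace = quadrangleMoment 0 0 (k + 1))
    (hBk : ∀ k, (B ^ (k + 1)).trace = triangleMoment 1 0 0 (k + 1)) :
    A.expTrace < B.expTrace := by
  have h2 : HasSum (fun k : ℕ => (2 : ℝ) ^ k / (k.factorial : ℝ)) (Real.exp 2) := by
    rw [Real.exp_eq_exp_ℝ]
    exact NormedSpace.expSeries_div_hasSum_exp _
  have h2' : HasSum (fun k : ℕ => (-2 : ℝ) ^ k / (k.factorial : ℝ)) (Real.exp (-2)) := by
    rw [Real.exp_eq_exp_ℝ]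
    exact NormedSpace.expSeries_div_hasSum_exp _
  -- The summand 2 at index zero accounts for the double eigenvalue 0 of the quadrangle.
  have hs := (h2.add h2').add (hasSum_ite_eq 0 (2 : ℝ))
  have hAe : A.expTrace = Real.exp 2 + Real.exp (-2) + 2 := by
    refine hA.hasSum_expTrace.unique (hs.congr_fun fun k => ?_)
    rcases k with _ | k
    -- At index zero both sides count the four eigenvalues.
    · simp [hV]
      norm_num
    · rw [hAk, quadrangleMoment_zero_zero]
      simp [add_div]
  -- All terms are nonnegative, so six of them give the lower bound 4 + 4 + 1 + 28/24 + 40/120 =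
  -- 21/2. The quadrangle has at most `exp 2 + 1 + 2`, which is below 10.4.
  have hBe := sum_le_hasSum (Finset.range 6) (fun k _ => by
    rcases k with _ | k
    · simp
    · rw [hBk]
      exact div_nonneg (triangleMoment_nonneg (by norm_num) le_rfl le_rfl _) (by positivity))
    hB.hasSum_expTrace
  have e0 : (B ^ 0).trace = 4 := by simp [hW]
  have e1 : (B ^ 1).trace = 0 := by rw [hBk 0, triangleMoment_one]
  have e2 : (B ^ 2).trace = 8 := by rw [hBk 1, triangleMoment_two]; norm_num
  have e3 : (B ^ 3).trace = 6 := by rw [hBk 2, triangleMoment_three]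
  have e4 : (B ^ 4).trace = 28 := by rw [hBk 3, triangleMoment_four]; norm_num
  have e5 : (B ^ 5).trace = 40 := by rw [hBk 4, triangleMoment_five]; norm_num
  simp only [Finset.sum_range_succ, Finset.sum_range_zero, e0, e1, e2, e3, e4, e5,
    Nat.factorial] at hBe
  norm_num at hBe
  have hx := Real.exp_one_lt_d9
  have hx0 := Real.exp_pos 1
  have hx2 : Real.exp 2 = Real.exp 1 ^ 2 := by
    rw [← Real.exp_nat_mul]
    norm_num
  have hy : Real.exp (-2) ≤ 1 := Real.exp_le_one_iff.2 (by norm_num)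
  rw [hAe]
  nlinarith

/-! ### Moving neighbours between two nonadjacent vertices -/

section Rotation

variable {V : Type*} [DecidableEq V]

/-- The orthogonal involution that sends the unit vectors `e u` and `e v` to
`(e u + e v) / √2` and `(e u - e v) / √2`, and fixes the other unit vectors. -/
noncomputable def pairRotation (u v : V) : Matrix V V ℝ := Matrix.of fun x y =>
  if y = u then (if x = u then √(1 / 2) else 0) + (if x = v then √(1 / 2) else 0)
  else if y = v then (if x = u then √(1 / 2) else 0) - (if x = v then √(1 / 2) else 0)
  else if x = y then 1 else 0

theorem pairRotation_transpose {u v : V} (huv : u ≠ v) :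
    (pairRotation u v)ᵀ = pairRotation u v := by
  ext x y
  simp only [transpose_apply, pairRotation, of_apply]
  by_cases hxu : x = u <;> by_cases hxv : x = v <;> by_cases hyu : y = u <;>
    by_cases hyv : y = v <;> by_cases hxy : x = y <;> subst_vars <;> simp_all [eq_comm]

variable [Fintype V]

theorem mul_pairRotation_apply (u v : V) (M : Matrix V V ℝ) (x y : V) :
    (M * pairRotation u v) x y =
      if y = u then √(1 / 2) * (M x u + M x v)
      else if y = v then √(1 / 2) * (M x u - M x v)
      else M x y := by
  simp only [mul_apply, pairRotation, of_apply]
  split_ifs with h1 h2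
  · simp [mul_add, Finset.sum_add_distrib]
    ring
  · simp [mul_sub, Finset.sum_sub_distrib]
    ring
  · simp

theorem pairRotation_mul_apply {u v : V} (huv : u ≠ v) (M : Matrix V V ℝ) (x y : V) :
    (pairRotation u v * M) x y =
      if x = u then √(1 / 2) * (M u y + M v y)
      else if x = v then √(1 / 2) * (M u y - M v y)
      else M x y := by
  have h : pairRotation u v * M = (Mᵀ * pairRotation u v)ᵀ := by
    rw [transpose_mul, pairRotation_transpose huv, transpose_transpose]
  rw [h, transpose_apply, mul_pairRotation_apply]
  rfl

theorem pairRotation_mul_self {u v : V} (huv : u ≠ v) :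
    pairRotation u v * pairRotation u v = 1 := by
  have hs : √(1 / 2 : ℝ) * √(1 / 2 : ℝ) = 1 / 2 := Real.mul_self_sqrt (by norm_num)
  ext x y
  rw [mul_pairRotation_apply]
  simp only [pairRotation, of_apply, one_apply]
  by_cases hxu : x = u <;> by_cases hxv : x = v <;> by_cases hyu : y = u <;>
    by_cases hyv : y = v <;> by_cases hxy : x = y <;> subst_vars <;>
    simp_all [eq_comm, huv.symm] <;> nlinarith

/-- Since the block of `M` on `u`, `v` vanishes, conjugation only replaces the rest of these two
rows and columns by normalized sums and differences. -/
theorem conj_pairRotation_apply {u v : V} (huv : u ≠ v) {M : Matrix V V ℝ}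
    (hM : M.IsHermitian) (h1 : M u u = 0) (h2 : M u v = 0) (h3 : M v v = 0) (x y : V) :
    (pairRotation u v * M * pairRotation u v) x y =
      if x = u ∨ x = v then
        if y = u ∨ y = v then 0
        else √(1 / 2) * (if x = u then M y u + M y v else M y u - M y v)
      else
        if y = u then √(1 / 2) * (M x u + M x v)
        else if y = v then √(1 / 2) * (M x u - M x v)
        else M x y := by
  have h4 : M v u = 0 := by
    have := hM.apply u v
    rw [star_trivial] at this
    rw [this, h2]
  have e1 : ∀ y, M u y = M y u := fun y => by simpa using hM.apply y u
  have e2 : ∀ y, M v y = M y v := fun y => by simpa using hM.apply y v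
  rw [mul_pairRotation_apply]
  simp only [pairRotation_mul_apply huv]
  have e3 := e1 y
  have e4 := e2 y
  clear e1 e2
  by_cases hyu : y = u
  · subst hyu
    by_cases hxu : x = y
    · subst hxu
      simp [h1, h2, h3, h4]
    · by_cases hxv : x = v
      · subst hxv
        simp [hxu, h1, h2, h3, h4]
      · simp [hxu, hxv]
  · by_cases hyv : y = v
    · subst hyv
      by_cases hxu : x = u
      · subst hxu
        simp [hyu, h1, h2, h3, h4]
      · by_cases hxv : x = y
        · subst hxv
          simp [hxu, h1, h2, h3, h4]
        · simp [hxu, hxv, hyu]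
    · by_cases hxu : x = u
      · subst hxu
        simp [hyu, hyv, e3, e4]
      · by_cases hxv : x = v
        · subst hxv
          simp [hxu, hyu, hyv, e3, e4]
        · simp [hxu, hxv, hyu, hyv]

theorem isHermitian_conj_pairRotation {u v : V} (huv : u ≠ v) {M : Matrix V V ℝ}
    (hM : M.IsHermitian) : (pairRotation u v * M * pairRotation u v).IsHermitian := by
  have := isHermitian_mul_mul_conjTranspose (pairRotation u v) hM
  rwa [conjTranspose_eq_transpose_of_trivial, pairRotation_transpose huv] at this

end Rotation

namespace SimpleGraph

variable {V : Type*}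

open Classical in
/-- The adjacency matrix with real entries, with classical decidability. -/
noncomputable def realAdj (G : SimpleGraph V) : Matrix V V ℝ :=
  Matrix.of fun x y => if G.Adj x y then 1 else 0

theorem realAdj_of_adj {G : SimpleGraph V} {x y : V} (h : G.Adj x y) : G.realAdj x y = 1 := by
  simp [realAdj, h]

theorem realAdj_of_not_adj {G : SimpleGraph V} {x y : V} (h : ¬ G.Adj x y) :
    G.realAdj x y = 0 := by
  simp [realAdj, h]

theorem realAdj_nonneg (G : SimpleGraph V) (x y : V) : 0 ≤ G.realAdj x y := by
  simp only [realAdj, of_apply]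
  split_ifs <;> simp

theorem realAdj_isHermitian (G : SimpleGraph V) : G.realAdj.IsHermitian := by
  ext x y
  rw [conjTranspose_apply, star_trivial]
  by_cases h : G.Adj x y
  · rw [realAdj_of_adj h, realAdj_of_adj h.symm]
  · rw [realAdj_of_not_adj h, realAdj_of_not_adj fun h' => h h'.symm]

theorem trace_realAdj_sq [Fintype V] [DecidableEq V] (G : SimpleGraph V) :
    (G.realAdj ^ 2).trace = 2 * (Nat.card G.edgeSet : ℝ) := by
  classical
  have h : G.realAdj = G.adjMatrix ℝ := by
    ext x y
    simp [realAdj, adjMatrix_apply]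
  have h2 := G.sum_degrees_eq_twice_card_edges
  rw [h, sq, trace]
  simp only [diag_apply, adjMatrix_mul_self_apply_self]
  rw [Nat.card_eq_fintype_card, ← edgeFinset_card]
  exact_mod_cast h2

/-- The graph in which the neighbours of `v` that are not neighbours of `u` have been moved
from `v` to `u`. -/
def moveNeighbors (G : SimpleGraph V) (u v : V) : SimpleGraph V where
  Adj x y := (G.Adj x y ∧ ¬ (x = v ∧ ¬ G.Adj u y) ∧ ¬ (y = v ∧ ¬ G.Adj u x)) ∨
    (x = u ∧ y ≠ u ∧ G.Adj v y) ∨ (y = u ∧ x ≠ u ∧ G.Adj v x)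
  symm := ⟨fun x y h => by
    rw [G.adj_comm y x]
    tauto⟩
  loopless := ⟨fun x h => by
    rcases h with h | h | h
    · exact G.loopless.irrefl x h.1
    · exact h.2.1 h.1
    · exact h.2.1 h.1⟩

variable {G : SimpleGraph V} {u v : V}

theorem moveNeighbors_adj_iff {x y : V} : (G.moveNeighbors u v).Adj x y ↔
    (G.Adj x y ∧ ¬ (x = v ∧ ¬ G.Adj u y) ∧ ¬ (y = v ∧ ¬ G.Adj u x)) ∨
    (x = u ∧ y ≠ u ∧ G.Adj v y) ∨ (y = u ∧ x ≠ u ∧ G.Adj v x) := Iff.rfl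

theorem moveNeighbors_realAdj_left (huv : u ≠ v) {x : V} (hu : x ≠ u)
    (hv : x ≠ v) : (G.moveNeighbors u v).realAdj x u = max (G.realAdj x u) (G.realAdj x v) := by
  have h : (G.moveNeighbors u v).Adj x u ↔ G.Adj x u ∨ G.Adj x v := by
    rw [moveNeighbors_adj_iff, G.adj_comm v x]
    tauto
  by_cases a : G.Adj x u <;> by_cases b : G.Adj x v <;> simp [realAdj, h, a, b]

theorem moveNeighbors_realAdj_right (huv : u ≠ v) {x : V} (hu : x ≠ u)
    (hv : x ≠ v) : (G.moveNeighbors u v).realAdj x v = min (G.realAdj x u) (G.realAdj x v) := by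
  have h : (G.moveNeighbors u v).Adj x v ↔ G.Adj x u ∧ G.Adj x v := by
    rw [moveNeighbors_adj_iff, G.adj_comm u x]
    have := huv.symm
    tauto
  by_cases a : G.Adj x u <;> by_cases b : G.Adj x v <;> simp [realAdj, h, a, b]

theorem moveNeighbors_realAdj_of_ne {x y : V} (hxu : x ≠ u)
    (hxv : x ≠ v) (hyu : y ≠ u) (hyv : y ≠ v) :
    (G.moveNeighbors u v).realAdj x y = G.realAdj x y := by
  have h : (G.moveNeighbors u v).Adj x y ↔ G.Adj x y := by
    rw [moveNeighbors_adj_iff]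
    tauto
  by_cases a : G.Adj x y <;> simp [realAdj, h, a]

theorem moveNeighbors_not_adj (huv : u ≠ v) (hn : ¬ G.Adj u v) :
    ¬ (G.moveNeighbors u v).Adj u v := by
  simp [moveNeighbors, huv.symm, huv, hn]

/-- The common neighbour `c` keeps both its edges, so `u` and `v` stay connected, and a removed edge
at `v` is replaced by a walk through `u`. -/
theorem moveNeighbors_connected (hG : G.Connected) {c : V} (hc : G.Adj u c)
    (hc' : G.Adj v c) : (G.moveNeighbors u v).Connected := by
  have huc : (G.moveNeighbors u v).Adj u c := by
    right; left; exact ⟨rfl, hc.ne', hc'⟩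
  have hvc : (G.moveNeighbors u v).Adj v c := by
    left
    exact ⟨hc', fun h => h.2 hc, fun h => hc'.ne h.1.symm⟩
  have huv : (G.moveNeighbors u v).Reachable u v := huc.reachable.trans hvc.reachable.symm
  have hu : ∀ y, G.Adj v y → (G.moveNeighbors u v).Reachable u y := by
    intro y hy
    by_cases h : y = u
    · rw [h]
    · exact Adj.reachable (Or.inr (Or.inl ⟨rfl, h, hy⟩))
  have key : ∀ x y, G.Adj x y → (G.moveNeighbors u v).Reachable x y := by
    intro x y h
    by_cases hx : x = v
    · subst hx
      exact huv.symm.trans (hu y h)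
    by_cases hy : y = v
    · subst hy
      exact (hu x h.symm).symm.trans huv
    exact Adj.reachable (Or.inl ⟨h, fun h => hx h.1, fun h => hy h.1⟩)
  have := hG.nonempty
  refine Connected.mk fun x y => ?_
  obtain ⟨w⟩ := hG.preconnected x y
  induction w with
  | nil => rfl
  | cons h _ ih => exact (key _ _ h).trans ih

section Fintype

variable [Fintype V] [DecidableEq V]

/-- For the entries `a`, `b` of a row in columns `u`, `v`, the move puts the maximum in column `u`
and the minimum in column `v`. Their sum is `a + b` and their difference is `|a - b|`. -/
theorem abs_conj_eq (huv : u ≠ v) (hn : ¬ G.Adj u v) (x y : V) :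
    |(pairRotation u v * G.realAdj * pairRotation u v) x y| =
      (pairRotation u v * (G.moveNeighbors u v).realAdj * pairRotation u v) x y := by
  have hs := Real.sqrt_nonneg (1 / 2)
  have hp : ∀ x, x ≠ u → x ≠ v → |G.realAdj x u + G.realAdj x v| =
      (G.moveNeighbors u v).realAdj x u + (G.moveNeighbors u v).realAdj x v := by
    intro x hu hv
    rw [moveNeighbors_realAdj_left huv hu hv, moveNeighbors_realAdj_right huv hu hv,
      max_add_min, abs_of_nonneg (add_nonneg (realAdj_nonneg _ _ _) (realAdj_nonneg _ _ _))]
  have hm : ∀ x, x ≠ u → x ≠ v → |G.realAdj x u - G.realAdj x v| =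
      (G.moveNeighbors u v).realAdj x u - (G.moveNeighbors u v).realAdj x v := by
    intro x hu hv
    rw [moveNeighbors_realAdj_left huv hu hv, moveNeighbors_realAdj_right huv hu hv,
      max_sub_min_eq_abs']
  rw [conj_pairRotation_apply huv G.realAdj_isHermitian (realAdj_of_not_adj (G.loopless.irrefl u))
    (realAdj_of_not_adj hn) (realAdj_of_not_adj (G.loopless.irrefl v)),
    conj_pairRotation_apply huv (realAdj_isHermitian _)
    (realAdj_of_not_adj ((G.moveNeighbors u v).loopless.irrefl u))
    (realAdj_of_not_adj (moveNeighbors_not_adj huv hn))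
    (realAdj_of_not_adj ((G.moveNeighbors u v).loopless.irrefl v))]
  split_ifs with h1 h2 h3 h4 h5
  · simp
  · push Not at h2
    rw [abs_mul, abs_of_nonneg hs, hp y h2.1 h2.2]
  · push Not at h2
    rw [abs_mul, abs_of_nonneg hs, hm y h2.1 h2.2]
  · push Not at h1
    rw [abs_mul, abs_of_nonneg hs, hp x h1.1 h1.2]
  · push Not at h1
    rw [abs_mul, abs_of_nonneg hs, hm x h1.1 h1.2]
  · push Not at h1
    rw [moveNeighbors_realAdj_of_ne h1.1 h1.2 h4 h5, abs_of_nonneg (realAdj_nonneg _ _ _)]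

/-- The second moment is twice the number of edges. It is also the sum of the squared entries, which
ignores signs, so `abs_conj_eq` preserves it. -/
theorem card_edgeSet_moveNeighbors (huv : u ≠ v) (hn : ¬ G.Adj u v) :
    Nat.card (G.moveNeighbors u v).edgeSet = Nat.card G.edgeSet := by
  have h1 := trace_conj_pow (A := G.realAdj) (pairRotation_mul_self huv) 2
  have h2 := trace_conj_pow (A := (G.moveNeighbors u v).realAdj) (pairRotation_mul_self huv) 2
  have key : ∀ {L : Matrix V V ℝ}, L.IsHermitian →
      (L ^ 2).trace = ∑ i, ∑ j, |L i j| ^ 2 := by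
    intro L hL
    rw [sq]
    simp only [trace, diag, mul_apply]
    refine Finset.sum_congr rfl fun i _ => Finset.sum_congr rfl fun j _ => ?_
    have := hL.apply i j
    rw [star_trivial] at this
    rw [this, sq_abs, sq]
  rw [key (isHermitian_conj_pairRotation huv (realAdj_isHermitian _))] at h1 h2
  simp only [← abs_conj_eq huv hn, abs_abs] at h2
  rw [h1, trace_realAdj_sq, trace_realAdj_sq] at h2
  exact_mod_cast (mul_left_cancel₀ two_ne_zero h2).symm

/-- In the rotated square of the original matrix, the entry at `(u, v)` receives a positive term
from `x` and a negative one from `y`. They cancel in part, whereas after the move all terms are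
nonnegative; the fourth moment detects this. -/
theorem expTrace_lt_moveNeighbors (huv : u ≠ v) (hn : ¬ G.Adj u v) {x y : V}
    (hx : G.Adj u x) (hx' : ¬ G.Adj v x) (hy : G.Adj v y) (hy' : ¬ G.Adj u y) :
    G.realAdj.expTrace < (G.moveNeighbors u v).realAdj.expTrace := by
  have hH := pairRotation_mul_self huv
  have hle := fun i j => (abs_conj_eq huv hn i j).le
  have hM := isHermitian_conj_pairRotation huv G.realAdj_isHermitian
  have hN := isHermitian_conj_pairRotation huv (G.moveNeighbors u v).realAdj_isHermitian
  refine expTrace_lt (j := 4) (realAdj_isHermitian _) (realAdj_isHermitian _) (fun k => ?_) ?_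
  · rw [← trace_conj_pow hH, ← trace_conj_pow (A := (G.moveNeighbors u v).realAdj) hH]
    exact trace_pow_le hle k
  · rw [← trace_conj_pow hH, ← trace_conj_pow (A := (G.moveNeighbors u v).realAdj) hH]
    refine trace_pow_four_lt hM hN hle (u := u) (v := v) ?_
    set M := pairRotation u v * G.realAdj * pairRotation u v with hMdef
    set N := pairRotation u v * (G.moveNeighbors u v).realAdj * pairRotation u v
    have hab : ∀ z, |M u z * M z v| = N u z * N z v := fun z => by
      rw [abs_mul, abs_conj_eq huv hn, abs_conj_eq huv hn]
    have hs : 0 < √(1 / 2 : ℝ) := by positivity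
    have hMz : ∀ z, z ≠ u → z ≠ v → M u z * M z v =
        √(1 / 2) * (G.realAdj z u + G.realAdj z v) *
          (√(1 / 2) * (G.realAdj z u - G.realAdj z v)) := by
      intro z hu hv
      rw [hMdef]
      simp only [conj_pairRotation_apply huv G.realAdj_isHermitian
        (realAdj_of_not_adj (G.loopless.irrefl u)) (realAdj_of_not_adj hn)
        (realAdj_of_not_adj (G.loopless.irrefl v))]
      simp [hu, hv, huv.symm]
    have hxM : 0 < M u x * M x v := by
      rw [hMz x hx.ne' (by rintro rfl; exact hn hx), realAdj_of_adj hx.symm,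
        realAdj_of_not_adj (fun h => hx' h.symm)]
      simp
    have hyM : M u y * M y v < 0 := by
      rw [hMz y (by rintro rfl; exact hn hy.symm) hy.ne', realAdj_of_adj hy.symm,
        realAdj_of_not_adj (fun h => hy' h.symm)]
      simp
    rw [sq, sq, mul_apply, mul_apply, abs_lt, ← Finset.sum_neg_distrib]
    constructor
    · refine Finset.sum_lt_sum (fun z _ => ?_) ⟨x, Finset.mem_univ _, ?_⟩
      · rw [← hab]
        exact neg_abs_le _
      · rw [← hab]
        linarith [abs_nonneg (M u x * M x v)]
    · refine Finset.sum_lt_sum (fun z _ => ?_) ⟨y, Finset.mem_univ _, ?_⟩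
      · rw [← hab]
        exact le_abs_self _
      · rw [← hab]
        linarith [abs_nonneg (M u y * M y v)]

end Fintype

end SimpleGraph

namespace SimpleGraph

/-! ### Connected graphs with `n` edges and locally nested neighbourhoods -/

variable {V : Type*}

/-- Nonadjacent vertices with a common neighbour have nested neighbourhoods. -/
def LocallyNested (G : SimpleGraph V) : Prop :=
  ∀ u v c, u ≠ v → ¬ G.Adj u v → G.Adj u c → G.Adj v c →
    (∀ x, G.Adj u x → G.Adj v x) ∨ (∀ x, G.Adj v x → G.Adj u x)

/-- `a`, `b`, `c` form a triangle and all other vertices are pendant vertices attached to it. -/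
def IsTriangleWithPendants (G : SimpleGraph V) (a b c : V) : Prop :=
  G.Adj a b ∧ G.Adj a c ∧ G.Adj b c ∧ ∀ x, x ≠ a → x ≠ b → x ≠ c →
    (∀ z, G.Adj x z ↔ z = a) ∨ (∀ z, G.Adj x z ↔ z = b) ∨ (∀ z, G.Adj x z ↔ z = c)

/-- `a`, `b`, `d`, `c` form a quadrangle without chords and all other vertices are pendant
vertices attached to `a` or `b`. -/
def IsQuadrangleWithPendants (G : SimpleGraph V) (a b c d : V) : Prop :=
  G.Adj a b ∧ G.Adj a c ∧ G.Adj b d ∧ G.Adj c d ∧ ¬ G.Adj a d ∧ ¬ G.Adj b c ∧ a ≠ d ∧ b ≠ c ∧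
    ∀ x, x ≠ a → x ≠ b → x ≠ c → x ≠ d →
      (∀ z, G.Adj x z ↔ z = a) ∨ (∀ z, G.Adj x z ↔ z = b)

variable {G : SimpleGraph V}

/-- A locally nested connected graph has a vertex that dominates its neighbourhoods. -/
theorem LocallyNested.exists_center [Finite V] (hG : G.Connected) (hN : G.LocallyNested) :
    ∃ a, ∀ x, x ≠ a → ¬ G.Adj a x →
      (∃ c, G.Adj a c ∧ G.Adj x c) ∧ ∀ z, G.Adj x z → G.Adj a z := by
  classical
  have := Fintype.ofFinite V
  have := hG.nonempty
  -- Maximal degree decides the direction of nesting: a neighbourhood containing that of `a` must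
  -- equal it.
  obtain ⟨a, ha⟩ := G.exists_maximal_degree_vertex
  have hX : ∀ x, x ≠ a → ¬ G.Adj a x → (∃ c, G.Adj a c ∧ G.Adj x c) →
      ∀ z, G.Adj x z → G.Adj a z := by
    rintro x hx hax ⟨c, hc, hc'⟩
    rcases hN a x c hx.symm hax hc hc' with h | h
    · have hsub : G.neighborFinset a ⊆ G.neighborFinset x := by
        intro z hz
        rw [mem_neighborFinset] at hz ⊢
        exact h z hz
      have heq := Finset.eq_of_subset_of_card_le hsub (by
        rw [card_neighborFinset_eq_degree, card_neighborFinset_eq_degree, ← ha]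
        exact G.degree_le_maxDegree x)
      intro z hz
      rw [← mem_neighborFinset] at hz ⊢
      rwa [heq]
    · exact h
  -- No vertex is farther than two from `a`: by `hX`, a walk leaving a vertex at distance two
  -- returns to a neighbour of `a`.
  have hcov : ∀ x, x = a ∨ G.Adj a x ∨ ∃ c, G.Adj a c ∧ G.Adj x c := by
    intro x
    have hr := (reachable_iff_reflTransGen a x).1 (hG.preconnected a x)
    induction hr with
    | refl => exact Or.inl rfl
    | @tail y z _ hyz ih =>
      rcases ih with rfl | h | h
      · exact Or.inr (Or.inl hyz)
      · exact Or.inr (Or.inr ⟨y, h, hyz.symm⟩)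
      · by_cases hya : y = a
        · subst hya
          exact Or.inr (Or.inl hyz)
        by_cases hay : G.Adj a y
        · exact Or.inr (Or.inr ⟨y, hay, hyz.symm⟩)
        · exact Or.inr (Or.inl (hX y hya hay h z hyz))
  refine ⟨a, fun x hx hax => ?_⟩
  have hc : ∃ c, G.Adj a c ∧ G.Adj x c := by
    rcases hcov x with h | h | h
    · exact absurd h hx
    · exact absurd h hax
    · exact h
  exact ⟨hc, hX x hx hax hc⟩

/-- If a graph has as many edges as vertices and `p` is a parent function of a spanning tree, then
there is exactly one edge that does not join a vertex to its parent. -/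
theorem exists_extra_edge [Finite V] (hcard : Nat.card G.edgeSet = Nat.card V) (a : V)
    (p : V → V) (hp : ∀ x, x ≠ a → G.Adj x (p x))
    (hpp : ∀ x y, x ≠ a → y ≠ a → p x = y → p y = x → False) :
    ∃ u v, G.Adj u v ∧ ¬ (u ≠ a ∧ v = p u) ∧ ¬ (v ≠ a ∧ u = p v) ∧ ∀ x y, G.Adj x y →
      (x ≠ a ∧ y = p x) ∨ (y ≠ a ∧ x = p y) ∨ (x = u ∧ y = v) ∨ (x = v ∧ y = u) := by
  classical
  have := Fintype.ofFinite V
  set T : Finset (Sym2 V) := (Finset.univ.erase a).image fun x => s(x, p x) with hT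
  -- Two vertices could give the same parent edge only by being each other's parents, which `hpp`
  -- excludes. Hence exactly one edge is left outside `T`.
  have hTcard : T.card + 1 = Fintype.card V := by
    rw [hT, Finset.card_image_of_injOn, Finset.card_erase_add_one (Finset.mem_univ a),
      Finset.card_univ]
    intro x hx y hy hxy
    have hx' : x ≠ a := by simpa using hx
    have hy' : y ≠ a := by simpa using hy
    rcases Sym2.eq_iff.1 hxy with ⟨h, _⟩ | ⟨h, h'⟩
    · exact h
    · exact (hpp x y hx' hy' h' h.symm).elim
  have hsub : T ⊆ G.edgeFinset := by
    intro e he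
    obtain ⟨x, hx, rfl⟩ := Finset.mem_image.1 he
    rw [mem_edgeFinset, mem_edgeSet]
    exact hp x (by simpa using hx)
  have hone : (G.edgeFinset \ T).card = 1 := by
    rw [Finset.card_sdiff_of_subset hsub]
    rw [Nat.card_eq_fintype_card, Nat.card_eq_fintype_card, ← edgeFinset_card] at hcard
    omega
  obtain ⟨e, he⟩ := Finset.card_eq_one.1 hone
  induction e using Sym2.ind with
  | _ u v =>
    have huv : s(u, v) ∈ G.edgeFinset \ T := by rw [he]; exact Finset.mem_singleton_self _
    rw [Finset.mem_sdiff, mem_edgeFinset, mem_edgeSet] at huv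
    refine ⟨u, v, huv.1, ?_, ?_, ?_⟩
    · rintro ⟨h1, rfl⟩
      exact huv.2 (Finset.mem_image.2 ⟨u, by simpa using h1, rfl⟩)
    · rintro ⟨h1, rfl⟩
      exact huv.2 (Finset.mem_image.2 ⟨v, by simpa using h1, Sym2.eq_swap⟩)
    · intro x y hxy
      by_cases hm : s(x, y) ∈ T
      · obtain ⟨z, hz, hz'⟩ := Finset.mem_image.1 hm
        have hza : z ≠ a := by simpa using hz
        rcases Sym2.eq_iff.1 hz' with ⟨rfl, h⟩ | ⟨rfl, h⟩
        · exact Or.inl ⟨hza, h.symm⟩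
        · exact Or.inr (Or.inl ⟨hza, h.symm⟩)
      · have : s(x, y) ∈ G.edgeFinset \ T :=
          Finset.mem_sdiff.2 ⟨by rwa [mem_edgeFinset, mem_edgeSet], hm⟩
        rw [he, Finset.mem_singleton, Sym2.eq_iff] at this
        exact Or.inr (Or.inr this)

section

variable {a u v : V} {p : V → V}

/-- The extra edge `u v` closes a triangle with `a`. If another neighbour `y` of `a` had a child
`z`, then `y` and `u` would violate nestedness, with `z` private to `y` and `v` private to `u`. So
vertices at distance two from `a` hang from `u` or `v`. -/
theorem LocallyNested.isTriangleWithPendants (hN : G.LocallyNested)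
    (ha : ∀ x, x ≠ a → ¬ G.Adj a x → ∀ z, G.Adj x z → G.Adj a z)
    (hp : ∀ x, x ≠ a → G.Adj x (p x)) (hpa : ∀ x, G.Adj a x → p x = a)
    (hpn : ∀ x, x ≠ a → ¬ G.Adj a x → G.Adj a (p x))
    (huv : G.Adj u v) (hau : G.Adj a u) (hav : G.Adj a v)
    (hE : ∀ x y, G.Adj x y →
      (x ≠ a ∧ y = p x) ∨ (y ≠ a ∧ x = p y) ∨ (x = u ∧ y = v) ∨ (x = v ∧ y = u)) :
    G.IsTriangleWithPendants a u v := by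
  have hpu := hpa u hau
  have hpv := hpa v hav
  have hnadj : ∀ y, G.Adj a y → y ≠ u → y ≠ v → ¬ G.Adj y u ∧ ¬ G.Adj y v := by
    intro y hy hyu hyv
    have hpy := hpa y hy
    constructor
    · intro h
      rcases hE y u h with h | h | h | h
      · exact hau.ne' (h.2.trans hpy)
      · exact hy.ne' (h.2.trans hpu)
      · exact hyu h.1
      · exact hyv h.1
    · intro h
      rcases hE y v h with h | h | h | h
      · exact hav.ne' (h.2.trans hpy)
      · exact hy.ne' (h.2.trans hpv)
      · exact hyu h.1
      · exact hyv h.1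
  have hleaf : ∀ y, G.Adj a y → y ≠ u → y ≠ v → ∀ z, G.Adj y z → z = a := by
    intro y hy hyu hyv z hz
    by_contra hza
    have haz : ¬ G.Adj a z := by
      intro haz
      rcases hE y z hz with h | h | h | h
      · exact hza (h.2.trans (hpa y hy))
      · exact hy.ne' (h.2.trans (hpa z haz))
      · exact hyu h.1
      · exact hyv h.1
    have hyz : y = p z := by
      rcases hE y z hz with h | h | h | h
      · exact absurd (h.2.trans (hpa y hy)) hza
      · exact h.2
      · exact absurd h.1 hyu
      · exact absurd h.1 hyv
    rcases hN y u a hyu (hnadj y hy hyu hyv).1 hy.symm hau.symm with h | h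
    · rcases hE u z (h z hz) with h | h | h | h
      · exact hza (h.2.trans hpu)
      · exact hyu (hyz.trans h.2.symm)
      · exact haz (h.2 ▸ hav)
      · exact huv.ne h.1
    · exact (hnadj y hy hyu hyv).2 (h v huv)
  refine ⟨hau, hav, huv, fun x hxa hxu hxv => ?_⟩
  by_cases hax : G.Adj a x
  · left
    exact fun z => ⟨hleaf x hax hxu hxv z, fun h => h ▸ hax.symm⟩
  · right
    have hx : ∀ z, G.Adj x z ↔ z = p x := by
      refine fun z => ⟨fun h => ?_, fun h => h ▸ hp x hxa⟩
      have haz := ha x hxa hax z h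
      rcases hE x z h with h | h | h | h
      · exact h.2
      · exact absurd (h.2.trans (hpa z haz)) hxa
      · exact absurd h.1 hxu
      · exact absurd h.1 hxv
    by_cases h1 : p x = u
    · left; rwa [h1] at hx
    by_cases h2 : p x = v
    · right; rwa [h2] at hx
    exact absurd (hleaf (p x) (hpn x hxa hax) h1 h2 x (hp x hxa).symm) hxa

/-- With `b` the parent of `u`, the quadrangle is `a`, `b`, `u`, `v`. Any other neighbour of `a` is
a leaf, by nestedness against `b`, which has `u` as a neighbour. -/
theorem LocallyNested.isQuadrangleWithPendants (hN : G.LocallyNested)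
    (ha : ∀ x, x ≠ a → ¬ G.Adj a x → ∀ z, G.Adj x z → G.Adj a z)
    (hp : ∀ x, x ≠ a → G.Adj x (p x)) (hpa : ∀ x, G.Adj a x → p x = a)
    (hpn : ∀ x, x ≠ a → ¬ G.Adj a x → G.Adj a (p x))
    (huv : G.Adj u v) (hua : u ≠ a) (hau : ¬ G.Adj a u) (hav : G.Adj a v) (hpuv : v ≠ p u)
    (hE : ∀ x y, G.Adj x y →
      (x ≠ a ∧ y = p x) ∨ (y ≠ a ∧ x = p y) ∨ (x = u ∧ y = v) ∨ (x = v ∧ y = u)) :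
    ∃ b c, G.IsQuadrangleWithPendants a b c u := by
  have hpv := hpa v hav
  obtain ⟨b, hb⟩ : ∃ b, p u = b := ⟨_, rfl⟩
  rw [hb] at hpuv
  have hab : G.Adj a b := hb ▸ hpn u hua hau
  have hub : G.Adj u b := hb ▸ hp u hua
  have hpb := hpa b hab
  have hu : ∀ z, G.Adj u z → z = b ∨ z = v := by
    intro z h
    have haz := ha u hua hau z h
    rcases hE u z h with h | h | h | h
    · exact Or.inl (h.2.trans hb)
    · exact absurd (h.2.trans (hpa z haz)) hua
    · exact Or.inr h.2
    · exact absurd h.1 huv.ne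
  have hNN : ∀ y z, G.Adj a y → G.Adj a z → ¬ G.Adj y z := by
    intro y z hy hz h
    rcases hE y z h with h | h | h | h
    · exact hz.ne' (h.2.trans (hpa y hy))
    · exact hy.ne' (h.2.trans (hpa z hz))
    · exact hau (h.1 ▸ hy)
    · exact hau (h.2 ▸ hz)
  have hX : ∀ x, x ≠ a → ¬ G.Adj a x → x ≠ u → ∀ z, G.Adj x z ↔ z = p x := by
    intro x hxa hax hxu z
    refine ⟨fun h => ?_, fun h => h ▸ hp x hxa⟩
    have haz := ha x hxa hax z h
    rcases hE x z h with h | h | h | h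
    · exact h.2
    · exact absurd (h.2.trans (hpa z haz)) hxa
    · exact absurd h.1 hxu
    · exact absurd (h.1 ▸ hav) hax
  have hleaf : ∀ y, G.Adj a y → y ≠ b → y ≠ v → ∀ z, G.Adj y z → z = a := by
    intro y hy hyb hyv z hz
    by_contra hza
    have haz : ¬ G.Adj a z := fun haz => hNN y z hy haz hz
    rcases hN y b a hyb (hNN y b hy hab) hy.symm hab.symm with h | h
    · have hzu : z ≠ u := by
        rintro rfl
        rcases hu y hz.symm with h | h
        · exact hyb h
        · exact hyv h
      have h1 := (hX z hza haz hzu y).1 hz.symm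
      have h2 := (hX z hza haz hzu b).1 (h z hz).symm
      exact hyb (h1.trans h2.symm)
    · rcases hu y (h u hub.symm).symm with h | h
      · exact hyb h
      · exact hyv h
  have hpX : ∀ x, x ≠ a → ¬ G.Adj a x → x ≠ u → p x = b ∨ p x = v := by
    intro x hxa hax hxu
    by_contra! h
    exact hxa (hleaf (p x) (hpn x hxa hax) h.1 h.2 x (hp x hxa).symm)
  -- `b` and `v` are nonadjacent and share `a`, so pendants at both would violate nestedness. The
  -- one that carries pendants, if any, plays the role of the second vertex of the quadrangle.
  by_cases hex : ∃ x, x ≠ a ∧ ¬ G.Adj a x ∧ x ≠ u ∧ p x = v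
  · obtain ⟨x₁, h1, h2, h3, h4⟩ := hex
    refine ⟨v, b, hav, hab, huv.symm, hub.symm, hau, hNN v b hav hab, hua.symm, hpuv,
      fun x hxa hxv hxb hxu => ?_⟩
    by_cases hax : G.Adj a x
    · left
      exact fun z => ⟨hleaf x hax hxb hxv z, fun h => h ▸ hax.symm⟩
    · right
      rcases hpX x hxa hax hxu with h | h
      · exfalso
        rcases hN b v a hpuv.symm (hNN b v hab hav) hab.symm hav.symm with h' | h'
        · exact hpuv (((hX x hxa hax hxu v).1
            (h' x ((hX x hxa hax hxu b).2 h.symm).symm).symm).trans h)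
        · exact hpuv.symm (((hX x₁ h1 h2 h3 b).1
            (h' x₁ ((hX x₁ h1 h2 h3 v).2 h4.symm).symm).symm).trans h4)
      · rw [← h]
        exact hX x hxa hax hxu
  · push Not at hex
    refine ⟨b, v, hab, hav, hub.symm, huv.symm, hau, hNN b v hab hav, hua.symm, hpuv.symm,
      fun x hxa hxb hxv hxu => ?_⟩
    by_cases hax : G.Adj a x
    · left
      exact fun z => ⟨hleaf x hax hxb hxv z, fun h => h ▸ hax.symm⟩
    · right
      rcases hpX x hxa hax hxu with h | h
      · rw [← h]
        exact hX x hxa hax hxu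
      · exact absurd h (hex x hxa hax hxu)

end

/-- In the tree of depth at most two rooted at the centre, every edge at the root is a tree edge,
and vertices at distance two are adjacent only to neighbours of the root. So the extra edge either
joins two neighbours of the root, giving a triangle, or a neighbour to a vertex at distance two,
giving a quadrangle. -/
theorem LocallyNested.triangle_or_quadrangle [Finite V] (hG : G.Connected)
    (hcard : Nat.card G.edgeSet = Nat.card V) (hN : G.LocallyNested) :
    (∃ a b c, G.IsTriangleWithPendants a b c) ∨
      ∃ a b c d, G.IsQuadrangleWithPendants a b c d := by
  classical
  obtain ⟨a, ha⟩ := hN.exists_center hG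
  have hpar : ∀ x, ∃ y, (x ≠ a → G.Adj x y) ∧ (G.Adj a x → y = a) ∧
      (x ≠ a → ¬ G.Adj a x → G.Adj a y) := by
    intro x
    by_cases hxa : x = a
    · exact ⟨a, fun h => absurd hxa h, fun _ => rfl, fun h => absurd hxa h⟩
    by_cases hax : G.Adj a x
    · exact ⟨a, fun _ => hax.symm, fun _ => rfl, fun _ h => absurd hax h⟩
    · obtain ⟨⟨c, hc, hc'⟩, _⟩ := ha x hxa hax
      exact ⟨c, fun _ => hc', fun h => absurd h hax, fun _ _ => hc⟩
  choose p hp hpa hpn using hpar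
  obtain ⟨u, v, huv, h1, h2, hE⟩ := exists_extra_edge hcard a p hp (by
    intro x y hx hy hxy hyx
    by_cases hax : G.Adj a x
    · exact hy (hxy.symm.trans (hpa x hax))
    · have := hpn x hx hax
      rw [hxy] at this
      exact hx (hyx.symm.trans (hpa y this)))
  have hua : u ≠ a := by
    rintro rfl
    exact h2 ⟨huv.ne', (hpa v huv).symm⟩
  have hva : v ≠ a := by
    rintro rfl
    exact h1 ⟨huv.ne, (hpa u huv.symm).symm⟩
  have hE' : ∀ x y, G.Adj x y →
      (x ≠ a ∧ y = p x) ∨ (y ≠ a ∧ x = p y) ∨ (x = v ∧ y = u) ∨ (x = u ∧ y = v) := by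
    intro x y h
    have := hE x y h
    tauto
  have ha' := fun x hx hx' => (ha x hx hx').2
  by_cases hau : G.Adj a u
  · by_cases hav : G.Adj a v
    · exact Or.inl ⟨a, u, v, hN.isTriangleWithPendants ha' hp hpa hpn huv hau hav hE⟩
    · obtain ⟨b, c, h⟩ := hN.isQuadrangleWithPendants ha' hp hpa hpn huv.symm hva hav hau
        (fun h => h2 ⟨hva, h⟩) hE'
      exact Or.inr ⟨a, b, c, v, h⟩
  · obtain ⟨b, c, h⟩ := hN.isQuadrangleWithPendants ha' hp hpa hpn huv hua hau
      (ha' u hua hau v huv) (fun h => h1 ⟨hua, h⟩) hE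
    exact Or.inr ⟨a, b, c, u, h⟩

end SimpleGraph

namespace SimpleGraph

/-! ### Moments of the candidate graphs -/

variable {V : Type*} [Fintype V] {G : SimpleGraph V}

/-- A triangle with `p`, `q` and `r` pendant vertices at its vertices has the moments of
`triangleQuotient p q r`. -/
theorem IsTriangleWithPendants.exists_moments [DecidableEq V] {a b c : V}
    (h : G.IsTriangleWithPendants a b c) :
    ∃ p q r : ℕ, p + q + r + 3 = Fintype.card V ∧
      (∀ k, (G.realAdj ^ (k + 1)).trace = triangleMoment p q r (k + 1)) ∧
      (p = 0 ↔ ∀ x, x ≠ a → x ≠ b → x ≠ c → ¬ G.Adj x a) ∧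
      (q = 0 ↔ ∀ x, x ≠ a → x ≠ b → x ≠ c → ¬ G.Adj x b) ∧
      (r = 0 ↔ ∀ x, x ≠ a → x ≠ b → x ≠ c → ¬ G.Adj x c) := by
  classical
  obtain ⟨hab, hac, hbc, hx⟩ := h
  let κ : V → Fin 6 := fun x => if x = a then 0 else if x = b then 1 else if x = c then 2
    else if G.Adj x a then 3 else if G.Adj x b then 4 else 5
  have ka : κ a = 0 := by simp [κ]
  have kb : κ b = 1 := by simp [κ, hab.ne']
  have kc : κ c = 2 := by simp [κ, hac.ne', hbc.ne']
  have kx : ∀ x, x ≠ a → x ≠ b → x ≠ c →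
      (κ x = 3 ∧ ∀ z, G.Adj x z ↔ z = a) ∨ (κ x = 4 ∧ ∀ z, G.Adj x z ↔ z = b) ∨
        (κ x = 5 ∧ ∀ z, G.Adj x z ↔ z = c) := by
    intro x h1 h2 h3
    rcases hx x h1 h2 h3 with h | h | h
    · exact Or.inl ⟨by simp [κ, h1, h2, h3, h], h⟩
    · exact Or.inr (Or.inl ⟨by simp [κ, h1, h2, h3, h, hab.ne], h⟩)
    · exact Or.inr (Or.inr ⟨by simp [κ, h1, h2, h3, h, hac.ne, hbc.ne], h⟩)
  have k0 : ∀ x, κ x = 0 ↔ x = a := by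
    refine fun x => ⟨fun hk => ?_, fun h => h ▸ ka⟩
    by_contra h1
    by_cases h2 : x = b
    · simp [h2, kb] at hk
    by_cases h3 : x = c
    · simp [h3, kc] at hk
    rcases kx x h1 h2 h3 with h | h | h <;> simp [h.1] at hk
  have k1 : ∀ x, κ x = 1 ↔ x = b := by
    refine fun x => ⟨fun hk => ?_, fun h => h ▸ kb⟩
    by_contra h2
    by_cases h1 : x = a
    · simp [h1, ka] at hk
    by_cases h3 : x = c
    · simp [h3, kc] at hk
    rcases kx x h1 h2 h3 with h | h | h <;> simp [h.1] at hk
  have k2 : ∀ x, κ x = 2 ↔ x = c := by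
    refine fun x => ⟨fun hk => ?_, fun h => h ▸ kc⟩
    by_contra h3
    by_cases h1 : x = a
    · simp [h1, ka] at hk
    by_cases h2 : x = b
    · simp [h2, kb] at hk
    rcases kx x h1 h2 h3 with h | h | h <;> simp [h.1] at hk
  have hpend : ∀ x y, x ≠ a → x ≠ b → x ≠ c →
      G.realAdj x y = triangleQuotient 1 1 1 (κ x) (κ y) ∧
      G.realAdj y x = triangleQuotient 1 1 1 (κ y) (κ x) := by
    intro x y h1 h2 h3
    have hsymm : G.realAdj y x = G.realAdj x y := by simpa using G.realAdj_isHermitian.apply x y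
    rw [hsymm]
    rcases kx x h1 h2 h3 with ⟨hk, h⟩ | ⟨hk, h⟩ | ⟨hk, h⟩
    · have e : G.realAdj x y = if κ y = 0 then 1 else 0 := by simp [realAdj, h, k0]
      rw [e, hk]
      generalize κ y = j
      fin_cases j <;> simp [triangleQuotient]
    · have e : G.realAdj x y = if κ y = 1 then 1 else 0 := by simp [realAdj, h, k1]
      rw [e, hk]
      generalize κ y = j
      fin_cases j <;> simp [triangleQuotient]
    · have e : G.realAdj x y = if κ y = 2 then 1 else 0 := by simp [realAdj, h, k2]
      rw [e, hk]
      generalize κ y = j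
      fin_cases j <;> simp [triangleQuotient]
  -- With unit parameters the matrix is the adjacency pattern of the classes; multiplying its
  -- columns by the class sizes restores `p`, `q`, `r`.
  have hq : ∀ x y, G.realAdj x y = triangleQuotient 1 1 1 (κ x) (κ y) := by
    intro x y
    by_cases hxc : x ≠ a ∧ x ≠ b ∧ x ≠ c
    · exact (hpend x y hxc.1 hxc.2.1 hxc.2.2).1
    by_cases hyc : y ≠ a ∧ y ≠ b ∧ y ≠ c
    · exact (hpend y x hyc.1 hyc.2.1 hyc.2.2).2
    have hx' : x = a ∨ x = b ∨ x = c := by tauto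
    have hy' : y = a ∨ y = b ∨ y = c := by tauto
    rcases hx' with rfl | rfl | rfl <;> rcases hy' with rfl | rfl | rfl <;>
      simp [realAdj, ka, kb, kc, triangleQuotient, hab, hac, hbc, hab.symm, hac.symm, hbc.symm]
  let N : Fin 6 → ℕ := fun j => (Finset.univ.filter fun y => κ y = j).card
  have n0 : N 0 = 1 := Finset.card_eq_one.2 ⟨a, by ext x; simp [k0]⟩
  have n1 : N 1 = 1 := Finset.card_eq_one.2 ⟨b, by ext x; simp [k1]⟩
  have n2 : N 2 = 1 := Finset.card_eq_one.2 ⟨c, by ext x; simp [k2]⟩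
  have hN : ∀ j w, (∀ x, κ x = j ↔ x ≠ a ∧ x ≠ b ∧ x ≠ c ∧ G.Adj x w) →
      (N j = 0 ↔ ∀ x, x ≠ a → x ≠ b → x ≠ c → ¬ G.Adj x w) := by
    intro j w hj
    simp only [N, Finset.card_eq_zero, Finset.filter_eq_empty_iff, Finset.mem_univ,
      true_implies, hj]
    exact forall_congr' fun x => by tauto
  have hfib : ∀ x, (κ x = 3 ↔ x ≠ a ∧ x ≠ b ∧ x ≠ c ∧ G.Adj x a) ∧
      (κ x = 4 ↔ x ≠ a ∧ x ≠ b ∧ x ≠ c ∧ G.Adj x b) ∧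
      (κ x = 5 ↔ x ≠ a ∧ x ≠ b ∧ x ≠ c ∧ G.Adj x c) := by
    intro x
    by_cases h1 : x = a
    · simp [h1, ka]
    by_cases h2 : x = b
    · simp [h2, kb]
    by_cases h3 : x = c
    · simp [h3, kc]
    rcases kx x h1 h2 h3 with ⟨hk, h⟩ | ⟨hk, h⟩ | ⟨hk, h⟩ <;>
      simp [hk, h, h1, h2, h3, hab.ne, hac.ne, hbc.ne, hab.ne', hac.ne', hbc.ne']
  refine ⟨N 3, N 4, N 5, ?_, fun k => ?_, hN 3 a fun x => (hfib x).1,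
    hN 4 b fun x => (hfib x).2.1, hN 5 c fun x => (hfib x).2.2⟩
  · have := Finset.card_eq_sum_card_fiberwise (s := (Finset.univ : Finset V)) (f := κ)
      (t := Finset.univ) (fun _ _ => Finset.mem_univ _)
    rw [Finset.card_univ, Fin.sum_univ_six] at this
    change _ = N 0 + N 1 + N 2 + N 3 + N 4 + N 5 at this
    omega
  · rw [trace_pow_eq_quotient _ κ _ hq, triangleMoment]
    congr 2
    ext i j
    change triangleQuotient 1 1 1 i j * (N j : ℝ) = _
    fin_cases j <;> fin_cases i <;> simp [triangleQuotient, n0, n1, n2]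

/-- A quadrangle with `p` and `q` pendant vertices at two adjacent vertices has the moments of
`quadrangleQuotient p q`. -/
theorem IsQuadrangleWithPendants.exists_moments [DecidableEq V] {a b c d : V}
    (h : G.IsQuadrangleWithPendants a b c d) :
    ∃ p q : ℕ, p + q + 4 = Fintype.card V ∧
      ∀ k, (G.realAdj ^ (k + 1)).trace = quadrangleMoment p q (k + 1) := by
  classical
  obtain ⟨hab, hac, hbd, hcd, had, hbc, had', hbc', hx⟩ := h
  let κ : V → Fin 6 := fun x => if x = a then 0 else if x = b then 1 else if x = c then 2
    else if x = d then 5 else if G.Adj x a then 3 else 4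
  have ka : κ a = 0 := by simp [κ]
  have kb : κ b = 1 := by simp [κ, hab.ne']
  have kc : κ c = 2 := by simp [κ, hac.ne', hbc'.symm]
  have kd : κ d = 5 := by simp [κ, had'.symm, hbd.ne', hcd.ne']
  have kx : ∀ x, x ≠ a → x ≠ b → x ≠ c → x ≠ d →
      (κ x = 3 ∧ ∀ z, G.Adj x z ↔ z = a) ∨ (κ x = 4 ∧ ∀ z, G.Adj x z ↔ z = b) := by
    intro x h1 h2 h3 h4
    rcases hx x h1 h2 h3 h4 with h | h
    · exact Or.inl ⟨by simp [κ, h1, h2, h3, h4, h], h⟩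
    · exact Or.inr ⟨by simp [κ, h1, h2, h3, h4, h, hab.ne], h⟩
  have kinj : ∀ x, (κ x = 0 ↔ x = a) ∧ (κ x = 1 ↔ x = b) ∧ (κ x = 2 ↔ x = c) ∧
      (κ x = 5 ↔ x = d) := by
    intro x
    by_cases h1 : x = a
    · simp [h1, ka, hab.ne, hac.ne, had']
    by_cases h2 : x = b
    · simp [h2, kb, hab.ne', hbc', hbd.ne]
    by_cases h3 : x = c
    · simp [h3, kc, hac.ne', hbc'.symm, hcd.ne]
    by_cases h4 : x = d
    · simp [h4, kd, had'.symm, hbd.ne', hcd.ne']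
    rcases kx x h1 h2 h3 h4 with h | h <;> simp [h.1, h1, h2, h3, h4]
  have hpend : ∀ x y, x ≠ a → x ≠ b → x ≠ c → x ≠ d →
      G.realAdj x y = quadrangleQuotient 1 1 (κ x) (κ y) ∧
      G.realAdj y x = quadrangleQuotient 1 1 (κ y) (κ x) := by
    intro x y h1 h2 h3 h4
    have hsymm : G.realAdj y x = G.realAdj x y := by simpa using G.realAdj_isHermitian.apply x y
    rw [hsymm]
    rcases kx x h1 h2 h3 h4 with ⟨hk, h⟩ | ⟨hk, h⟩
    · have e : G.realAdj x y = if κ y = 0 then 1 else 0 := by simp [realAdj, h, (kinj y).1]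
      rw [e, hk]
      generalize κ y = j
      fin_cases j <;> simp [quadrangleQuotient]
    · have e : G.realAdj x y = if κ y = 1 then 1 else 0 := by simp [realAdj, h, (kinj y).2.1]
      rw [e, hk]
      generalize κ y = j
      fin_cases j <;> simp [quadrangleQuotient]
  have hq : ∀ x y, G.realAdj x y = quadrangleQuotient 1 1 (κ x) (κ y) := by
    intro x y
    by_cases hxc : x ≠ a ∧ x ≠ b ∧ x ≠ c ∧ x ≠ d
    · exact (hpend x y hxc.1 hxc.2.1 hxc.2.2.1 hxc.2.2.2).1
    by_cases hyc : y ≠ a ∧ y ≠ b ∧ y ≠ c ∧ y ≠ d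
    · exact (hpend y x hyc.1 hyc.2.1 hyc.2.2.1 hyc.2.2.2).2
    have hx' : x = a ∨ x = b ∨ x = c ∨ x = d := by tauto
    have hy' : y = a ∨ y = b ∨ y = c ∨ y = d := by tauto
    have had2 : ¬ G.Adj d a := fun h => had h.symm
    have hbc2 : ¬ G.Adj c b := fun h => hbc h.symm
    rcases hx' with rfl | rfl | rfl | rfl <;> rcases hy' with rfl | rfl | rfl | rfl <;>
      simp [realAdj, ka, kb, kc, kd, quadrangleQuotient, hab, hac, hbd, hcd, hab.symm, hac.symm,
        hbd.symm, hcd.symm, had, hbc, had2, hbc2]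
  let N : Fin 6 → ℕ := fun j => (Finset.univ.filter fun y => κ y = j).card
  have n0 : N 0 = 1 := Finset.card_eq_one.2 ⟨a, by ext x; simp [(kinj x).1]⟩
  have n1 : N 1 = 1 := Finset.card_eq_one.2 ⟨b, by ext x; simp [(kinj x).2.1]⟩
  have n2 : N 2 = 1 := Finset.card_eq_one.2 ⟨c, by ext x; simp [(kinj x).2.2.1]⟩
  have n5 : N 5 = 1 := Finset.card_eq_one.2 ⟨d, by ext x; simp [(kinj x).2.2.2]⟩
  refine ⟨N 3, N 4, ?_, fun k => ?_⟩
  · have := Finset.card_eq_sum_card_fiberwise (s := (Finset.univ : Finset V)) (f := κ)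
      (t := Finset.univ) (fun _ _ => Finset.mem_univ _)
    rw [Finset.card_univ, Fin.sum_univ_six] at this
    change _ = N 0 + N 1 + N 2 + N 3 + N 4 + N 5 at this
    omega
  · rw [trace_pow_eq_quotient _ κ _ hq, quadrangleMoment]
    congr 2
    ext i j
    change quadrangleQuotient 1 1 i j * (N j : ℝ) = _
    fin_cases j <;> fin_cases i <;> simp [quadrangleQuotient, n0, n1, n2, n5]

/-- `a`, `b`, `c` form a triangle and all other vertices are pendant vertices attached to `a`. -/
def IsTriangleWithPendantsAt (G : SimpleGraph V) (a b c : V) : Prop :=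
  a ≠ b ∧ a ≠ c ∧ b ≠ c ∧
    ∀ x y, G.Adj x y ↔ x ≠ y ∧ (x = a ∨ y = a ∨ (x = b ∧ y = c) ∨ (x = c ∧ y = b))

omit [Fintype V] in
theorem IsTriangleWithPendants.at_of_forall {a b c : V} (h : G.IsTriangleWithPendants a b c)
    (hb : ∀ x, x ≠ a → x ≠ b → x ≠ c → ¬ G.Adj x b)
    (hc : ∀ x, x ≠ a → x ≠ b → x ≠ c → ¬ G.Adj x c) : G.IsTriangleWithPendantsAt a b c := by
  obtain ⟨hab, hac, hbc, hx⟩ := h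
  have hp : ∀ x, x ≠ a → x ≠ b → x ≠ c → ∀ z, G.Adj x z ↔ z = a := by
    intro x h1 h2 h3
    rcases hx x h1 h2 h3 with h | h | h
    · exact h
    · exact absurd ((h b).2 rfl) (hb x h1 h2 h3)
    · exact absurd ((h c).2 rfl) (hc x h1 h2 h3)
  have hall : ∀ x, x ≠ a → G.Adj x a := by
    intro x h1
    by_cases h2 : x = b
    · exact h2 ▸ hab.symm
    by_cases h3 : x = c
    · exact h3 ▸ hac.symm
    exact (hp x h1 h2 h3 a).2 rfl
  refine ⟨hab.ne, hac.ne, hbc.ne, fun x y => ⟨fun h => ⟨h.ne, ?_⟩, ?_⟩⟩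
  · by_contra! hcon
    obtain ⟨h1, h2, h3, h4⟩ := hcon
    by_cases hxb : x = b
    · by_cases hyb : y = b
      · exact h.ne (hxb.trans hyb.symm)
      · exact h1 ((hp y h2 hyb (h3 hxb) x).1 h.symm)
    by_cases hxc : x = c
    · by_cases hyc : y = c
      · exact h.ne (hxc.trans hyc.symm)
      · exact h1 ((hp y h2 (h4 hxc) hyc x).1 h.symm)
    exact h2 ((hp x h1 hxb hxc y).1 h)
  · rintro ⟨hne, rfl | rfl | ⟨rfl, rfl⟩ | ⟨rfl, rfl⟩⟩
    · exact (hall y hne.symm).symm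
    · exact hall x hne
    · exact hbc
    · exact hbc.symm

omit [Fintype V] in
theorem IsTriangleWithPendantsAt.isTriangleWithPendants {a b c : V}
    (h : G.IsTriangleWithPendantsAt a b c) : G.IsTriangleWithPendants a b c := by
  obtain ⟨hab, hac, hbc, h⟩ := h
  refine ⟨by simp [h, hab], by simp [h, hac], by simp [h, hbc], fun x h1 h2 h3 => Or.inl
    fun z => ?_⟩
  rw [h]
  refine ⟨?_, ?_⟩
  · tauto
  · rintro rfl
    exact ⟨h1, Or.inr (Or.inl rfl)⟩

omit [Fintype V] in
theorem IsTriangleWithPendants.rotate {a b c : V} (h : G.IsTriangleWithPendants a b c) :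
    G.IsTriangleWithPendants b c a := by
  obtain ⟨hab, hac, hbc, hx⟩ := h
  refine ⟨hbc, hab.symm, hac.symm, fun x h1 h2 h3 => ?_⟩
  have := hx x h3 h1 h2
  tauto

theorem IsTriangleWithPendantsAt.trace_pow [DecidableEq V] {a b c : V}
    (h : G.IsTriangleWithPendantsAt a b c) (k : ℕ) :
    (G.realAdj ^ (k + 1)).trace = triangleMoment ((Fintype.card V : ℝ) - 3) 0 0 (k + 1) := by
  obtain ⟨p, q, r, hc, hm, -, hq, hr⟩ := h.isTriangleWithPendants.exists_moments
  obtain ⟨hab, hac, hbc, hadj⟩ := h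
  have q0 : q = 0 := hq.2 fun x h1 h2 h3 => by
    rw [hadj]
    have := hab.symm
    tauto
  have r0 : r = 0 := hr.2 fun x h1 h2 h3 => by
    rw [hadj]
    have := hac.symm
    tauto
  subst q0 r0
  have : (Fintype.card V : ℝ) - 3 = p := by
    rw [← hc]
    push_cast
    ring
  rw [hm, this]
  simp

/-- Two triangles with pendant vertices at one vertex are isomorphic if they have equally many
vertices. -/
theorem IsTriangleWithPendantsAt.exists_iso {W : Type*} [Fintype W] {H : SimpleGraph W}
    {a b c : V} {a' b' c' : W} (h : G.IsTriangleWithPendantsAt a b c)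
    (h' : H.IsTriangleWithPendantsAt a' b' c') (hcard : Fintype.card V = Fintype.card W) :
    Nonempty (G ≃g H) := by
  classical
  obtain ⟨hab, hac, hbc, hG⟩ := h
  obtain ⟨hab', hac', hbc', hH⟩ := h'
  obtain ⟨e⟩ : Nonempty (V ≃ W) := ⟨Fintype.equivOfCardEq hcard⟩
  -- An arbitrary bijection is corrected by three transpositions, each fixing the images already
  -- placed.
  let e1 := e.trans (Equiv.swap (e a) a')
  have e1a : e1 a = a' := by simp [e1]
  let e2 := e1.trans (Equiv.swap (e1 b) b')
  have e2a : e2 a = a' := by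
    have h1 : a' ≠ e1 b := fun h => hab (e1.injective (e1a.trans h))
    simp only [e2, Equiv.trans_apply, e1a]
    exact Equiv.swap_apply_of_ne_of_ne h1 hab'
  have e2b : e2 b = b' := by simp [e2]
  let e3 := e2.trans (Equiv.swap (e2 c) c')
  have e3a : e3 a = a' := by
    have h1 : a' ≠ e2 c := fun h => hac (e2.injective (e2a.trans h))
    simp only [e3, Equiv.trans_apply, e2a]
    exact Equiv.swap_apply_of_ne_of_ne h1 hac'
  have e3b : e3 b = b' := by
    have h1 : b' ≠ e2 c := fun h => hbc (e2.injective (e2b.trans h))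
    simp only [e3, Equiv.trans_apply, e2b]
    exact Equiv.swap_apply_of_ne_of_ne h1 hbc'
  have e3c : e3 c = c' := by simp [e3]
  refine ⟨⟨e3, fun {x y} => ?_⟩⟩
  rw [hG, hH, ← e3a, ← e3b, ← e3c]
  simp only [e3.injective.eq_iff, ne_eq]

end SimpleGraph

/-! ### Extremality among unsigned unicyclic graphs -/

namespace SimpleGraph

variable {V W : Type*} [Fintype V] [Fintype W] [DecidableEq V] [DecidableEq W]
  {G : SimpleGraph V} {H : SimpleGraph W}

/-- Equality forces `p * q + p * r + q * r = 0` through the fourth moment. Then two of the three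
counts vanish, and a rotation of the triangle brings the remaining one to the first vertex. -/
theorem IsTriangleWithPendants.expTrace_le {a b c : V} {a' b' c' : W}
    (hG : G.IsTriangleWithPendants a b c) (hH : H.IsTriangleWithPendantsAt a' b' c')
    (hcard : Fintype.card V = Fintype.card W) :
    G.realAdj.expTrace ≤ H.realAdj.expTrace ∧
      (G.realAdj.expTrace = H.realAdj.expTrace → ∃ x y z, G.IsTriangleWithPendantsAt x y z) := by
  obtain ⟨p, q, r, hn, hm, hp, hq, hr⟩ := hG.exists_moments
  have hW : ((Fintype.card W : ℝ) - 3) = p + q + r := by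
    rw [← hcard, ← hn]
    push_cast
    ring
  have hmH := hH.trace_pow
  rw [hW] at hmH
  have hle : ∀ k, (G.realAdj ^ k).trace ≤ (H.realAdj ^ k).trace := by
    intro k
    rcases k with _ | k
    · simp [hcard]
    · rw [hm, hmH]
      exact triangleMoment_le (Nat.cast_nonneg _) (Nat.cast_nonneg _) (Nat.cast_nonneg _) _
  refine ⟨Matrix.expTrace_le G.realAdj_isHermitian H.realAdj_isHermitian hle, fun heq => ?_⟩
  have h0 : p * q + p * r + q * r = 0 := by
    by_contra hne
    refine (Matrix.expTrace_lt G.realAdj_isHermitian H.realAdj_isHermitian hle (j := 4) ?_).ne heq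
    rw [hm 3, hmH 3]
    refine triangleMoment_four_lt ?_
    exact_mod_cast Nat.pos_of_ne_zero hne
  have hpq : p = 0 ∨ q = 0 := mul_eq_zero.1 (by omega)
  have hpr : p = 0 ∨ r = 0 := mul_eq_zero.1 (by omega)
  have hqr : q = 0 ∨ r = 0 := mul_eq_zero.1 (by omega)
  rcases hpq with hp0 | hq0
  · rcases hqr with hq0 | hr0
    · exact ⟨c, a, b, hG.rotate.rotate.at_of_forall (fun x h1 h2 h3 => hp.1 hp0 x h2 h3 h1)
        fun x h1 h2 h3 => hq.1 hq0 x h2 h3 h1⟩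
    · exact ⟨b, c, a, hG.rotate.at_of_forall (fun x h1 h2 h3 => hr.1 hr0 x h3 h1 h2)
        fun x h1 h2 h3 => hp.1 hp0 x h3 h1 h2⟩
  · rcases hpr with hp0 | hr0
    · exact ⟨c, a, b, hG.rotate.rotate.at_of_forall (fun x h1 h2 h3 => hp.1 hp0 x h2 h3 h1)
        fun x h1 h2 h3 => hq.1 hq0 x h2 h3 h1⟩
    · exact ⟨a, b, c, hG.at_of_forall (hq.1 hq0) (hr.1 hr0)⟩

/-- With a pendant vertex, all moments compare and the third is strict, as only the other graph has
a triangle. The bare quadrangle needs the numerical comparison. -/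
theorem IsQuadrangleWithPendants.expTrace_lt {a b c d : V} {a' b' c' : W}
    (hG : G.IsQuadrangleWithPendants a b c d) (hH : H.IsTriangleWithPendantsAt a' b' c')
    (hcard : Fintype.card V = Fintype.card W) :
    G.realAdj.expTrace < H.realAdj.expTrace := by
  obtain ⟨p, q, hn, hm⟩ := hG.exists_moments
  have hW : ((Fintype.card W : ℝ) - 3) = p + q + 1 := by
    rw [← hcard, ← hn]
    push_cast
    ring
  have hmH := hH.trace_pow
  rw [hW] at hmH
  rcases Nat.eq_zero_or_pos (p + q) with h0 | hpos
  · obtain ⟨rfl, rfl⟩ : p = 0 ∧ q = 0 := by omega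
    refine expTrace_lt_of_quadrangle G.realAdj_isHermitian H.realAdj_isHermitian (by omega)
      (by omega) (fun k => ?_) fun k => ?_
    · simpa using hm k
    · simpa using hmH k
  · have h1 : (1 : ℝ) ≤ p + q := by exact_mod_cast hpos
    refine Matrix.expTrace_lt G.realAdj_isHermitian H.realAdj_isHermitian (fun k => ?_)
      (j := 3) ?_
    · rcases k with _ | k
      · simp [hcard]
      · rw [hm, hmH]
        refine quadrangleMoment_le (Nat.cast_nonneg _) (Nat.cast_nonneg _) h1 ?_ _
        rcases Nat.eq_zero_or_pos p with hp | hp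
        · simp [hp]
        rcases Nat.eq_zero_or_pos q with hq | hq
        · simp [hq]
        right
        exact ⟨by exact_mod_cast hp, by exact_mod_cast hq⟩
    · rw [hm 2, hmH 2]
      exact quadrangleMoment_three_lt _ _

/-- A connected graph with as many edges as vertices that maximizes `expTrace` is locally
nested. -/
theorem locallyNested_of_forall_le (hG : G.Connected)
    (hcard : Nat.card G.edgeSet = Nat.card V)
    (hmax : ∀ G' : SimpleGraph V, G'.Connected → Nat.card G'.edgeSet = Nat.card V →
      G'.realAdj.expTrace ≤ G.realAdj.expTrace) : G.LocallyNested := by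
  intro u v c huv hn hu hv
  by_contra! h
  obtain ⟨⟨x, hx, hx'⟩, ⟨y, hy, hy'⟩⟩ := h
  exact (expTrace_lt_moveNeighbors huv hn hx hx' hy hy').not_ge
    (hmax _ (moveNeighbors_connected hG hu hv) ((card_edgeSet_moveNeighbors huv hn).trans hcard))

/-- Among the connected graphs with as many edges as vertices, the triangle with pendant vertices
at one vertex maximizes `expTrace`. -/
theorem expTrace_le_of_unicyclic {a b c : W} (hH : H.IsTriangleWithPendantsAt a b c)
    (hVW : Fintype.card V = Fintype.card W) (hG : G.Connected)
    (hcard : Nat.card G.edgeSet = Nat.card V) :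
    G.realAdj.expTrace ≤ H.realAdj.expTrace ∧
      (G.realAdj.expTrace = H.realAdj.expTrace →
        ∃ x y z, G.IsTriangleWithPendantsAt x y z) := by
  have key : ∀ G : SimpleGraph V, G.Connected → Nat.card G.edgeSet = Nat.card V →
      (∀ G' : SimpleGraph V, G'.Connected → Nat.card G'.edgeSet = Nat.card V →
        G'.realAdj.expTrace ≤ G.realAdj.expTrace) →
      G.realAdj.expTrace ≤ H.realAdj.expTrace ∧ (G.realAdj.expTrace = H.realAdj.expTrace →
        ∃ x y z, G.IsTriangleWithPendantsAt x y z) := by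
    intro G hG hcard hmax
    rcases (locallyNested_of_forall_le hG hcard hmax).triangle_or_quadrangle hG hcard with
      ⟨x, y, z, h⟩ | ⟨x, y, z, w, h⟩
    · exact h.expTrace_le hH hVW
    · have := h.expTrace_lt hH hVW
      exact ⟨this.le, fun h => absurd h this.ne⟩
  -- There are finitely many graphs on `V`, so a maximizer exists, and `key` bounds it.
  obtain ⟨G₀, ⟨h1, h2⟩, h3⟩ := Set.exists_max_image
    {G : SimpleGraph V | G.Connected ∧ Nat.card G.edgeSet = Nat.card V}
    (fun G => G.realAdj.expTrace) (Set.toFinite _) ⟨G, hG, hcard⟩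
  have hle := (key G₀ h1 h2 fun G' h h' => h3 G' ⟨h, h'⟩).1
  -- A graph that attains the bound is itself a maximizer, so `key` applies to it directly.
  refine ⟨(h3 G ⟨hG, hcard⟩).trans hle, fun heq => (key G hG hcard fun G' h h' => ?_).2 heq⟩
  rw [heq]
  exact (h3 G' ⟨h, h'⟩).trans hle

end SimpleGraph

/-- Domination of entries makes the third moment strictly larger if a product along a closed walk
of length three becomes strictly larger. -/
theorem Matrix.trace_pow_three_lt {V : Type*} [Fintype V] [DecidableEq V] {M N : Matrix V V ℝ}
    (h : ∀ i j, |M i j| ≤ N i j) {a b c : V}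
    (habc : M a b * M b c * M c a < N a b * N b c * N c a) :
    (M ^ 3).trace < (N ^ 3).trace := by
  have key : ∀ L : Matrix V V ℝ, (L ^ 3).trace = ∑ i, ∑ k, ∑ j, L i j * L j k * L k i := by
    intro L
    have e : L ^ 3 = L * L * L := by rw [pow_succ, sq]
    simp only [e, trace, diag, mul_apply, Finset.sum_mul]
  have hle : ∀ i j k, M i j * M j k * M k i ≤ N i j * N j k * N k i := by
    intro i j k
    refine (le_abs_self _).trans ?_
    rw [abs_mul, abs_mul]
    exact mul_le_mul (mul_le_mul (h i j) (h j k) (abs_nonneg _) ((abs_nonneg _).trans (h i j)))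
      (h k i) (abs_nonneg _)
      (mul_nonneg ((abs_nonneg _).trans (h i j)) ((abs_nonneg _).trans (h j k)))
  rw [key, key]
  refine Finset.sum_lt_sum (fun i _ => Finset.sum_le_sum fun k _ => Finset.sum_le_sum
    fun j _ => hle i j k) ⟨a, Finset.mem_univ _, ?_⟩
  refine Finset.sum_lt_sum (fun k _ => Finset.sum_le_sum fun j _ => hle a j k)
    ⟨c, Finset.mem_univ _, ?_⟩
  exact Finset.sum_lt_sum (fun j _ => hle a j c) ⟨b, Finset.mem_univ _, habc⟩

/-! ### Signed graphs: invariance of the index and switching to positive signs -/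

namespace SignedGraph

variable {V : Type*} (Γ : SignedGraph V)

theorem estradaIndex_eq_expTrace [Fintype V] [DecidableEq V] :
    Γ.estradaIndex = Γ.adjMatrix.expTrace := by
  rw [Γ.adjMatrix_isHermitian.expTrace_eq, estradaIndex]
  congr!

variable {Γ}

theorem adjMatrix_of_adj {i j : V} (h : Γ.graph.Adj i j) :
    Γ.adjMatrix i j = ((Γ.sign ⟨s(i, j), h⟩ : ℤ) : ℝ) := by
  simp [adjMatrix, h]

theorem adjMatrix_of_not_adj {i j : V} (h : ¬ Γ.graph.Adj i j) : Γ.adjMatrix i j = 0 := by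
  simp [adjMatrix, h]

theorem adjMatrix_eq_or {i j : V} (h : Γ.graph.Adj i j) :
    Γ.adjMatrix i j = 1 ∨ Γ.adjMatrix i j = -1 := by
  rw [adjMatrix_of_adj h]
  rcases Int.units_eq_one_or (Γ.sign ⟨s(i, j), h⟩) with e | e <;> simp [e]

theorem sign_eq_one_iff {i j : V} (h : Γ.graph.Adj i j) :
    Γ.sign ⟨s(i, j), h⟩ = 1 ↔ Γ.adjMatrix i j = 1 := by
  rw [adjMatrix_of_adj h]
  rcases Int.units_eq_one_or (Γ.sign ⟨s(i, j), h⟩) with e | e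
  · simp [e]
  · rw [e]
    norm_num

theorem adjMatrix_comm (i j : V) : Γ.adjMatrix i j = Γ.adjMatrix j i := by
  simpa using Γ.adjMatrix_isHermitian.apply j i

theorem abs_adjMatrix (i j : V) : |Γ.adjMatrix i j| = Γ.graph.realAdj i j := by
  by_cases h : Γ.graph.Adj i j
  · rw [SimpleGraph.realAdj_of_adj h]
    rcases adjMatrix_eq_or h with e | e <;> simp [e]
  · rw [SimpleGraph.realAdj_of_not_adj h, adjMatrix_of_not_adj h, abs_zero]

open Classical in
theorem adjMatrix_switch (Z : Set V) (i j : V) : (Γ.switch Z).adjMatrix i j =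
    (if i ∈ Z then -1 else 1) * Γ.adjMatrix i j * (if j ∈ Z then -1 else 1) := by
  by_cases h : Γ.graph.Adj i j
  · have h' : (Γ.switch Z).graph.Adj i j := h
    rw [adjMatrix_of_adj h, adjMatrix_of_adj h']
    have hcond : (∃ u ∈ Z, ∃ v ∉ Z, s(i, j) = s(u, v)) ↔
        (i ∈ Z ∧ j ∉ Z) ∨ (j ∈ Z ∧ i ∉ Z) := by
      constructor
      · rintro ⟨u, hu, v, hv, he⟩
        rcases Sym2.eq_iff.1 he with ⟨rfl, rfl⟩ | ⟨rfl, rfl⟩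
        · exact Or.inl ⟨hu, hv⟩
        · exact Or.inr ⟨hu, hv⟩
      · rintro (⟨h1, h2⟩ | ⟨h1, h2⟩)
        · exact ⟨i, h1, j, h2, rfl⟩
        · exact ⟨j, h1, i, h2, Sym2.eq_swap⟩
    simp only [switch, hcond]
    by_cases hi : i ∈ Z <;> by_cases hj : j ∈ Z <;> simp [hi, hj]
  · have h' : ¬ (Γ.switch Z).graph.Adj i j := h
    rw [adjMatrix_of_not_adj h, adjMatrix_of_not_adj h', mul_zero, zero_mul]

theorem estradaIndex_switch [Fintype V] (Z : Set V) :
    (Γ.switch Z).estradaIndex = Γ.estradaIndex := by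
  classical
  rw [estradaIndex_eq_expTrace, estradaIndex_eq_expTrace]
  set D : Matrix V V ℝ := diagonal fun i => if i ∈ Z then -1 else 1 with hD
  have hDD : D * D = 1 := by
    rw [hD, diagonal_mul_diagonal, ← diagonal_one]
    congr 1
    ext i
    split_ifs <;> norm_num
  have h : (Γ.switch Z).adjMatrix = D * Γ.adjMatrix * D := by
    ext i j
    rw [adjMatrix_switch, hD, mul_diagonal, diagonal_mul]
  refine expTrace_congr fun k => ?_
  rw [h, trace_conj_pow hDD]

theorem Isomorphic.estradaIndex_eq {W : Type*} [Fintype V] [Fintype W] {Δ : SignedGraph W}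
    (h : Γ.Isomorphic Δ) : Γ.estradaIndex = Δ.estradaIndex := by
  classical
  obtain ⟨f, hf⟩ := h
  rw [estradaIndex_eq_expTrace, estradaIndex_eq_expTrace]
  have hA : ∀ x y, Γ.adjMatrix x y = Δ.adjMatrix (f x) (f y) := by
    intro x y
    by_cases hxy : Γ.graph.Adj x y
    · rw [adjMatrix_of_adj hxy, adjMatrix_of_adj (f.map_adj_iff.2 hxy), hf x y hxy]
    · rw [adjMatrix_of_not_adj hxy, adjMatrix_of_not_adj (fun h => hxy (f.map_adj_iff.1 h))]
  refine expTrace_congr fun k => ?_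
  rcases k with _ | k
  · simp [Fintype.card_congr f.toEquiv]
  -- The isomorphism serves as a class map whose fibres are singletons, so the quotient matrix is
  -- that of `Δ`.
  · rw [trace_pow_eq_quotient Γ.adjMatrix f Δ.adjMatrix hA]
    congr 2
    ext i j
    have : (Finset.univ.filter fun y => f y = j) = {f.symm j} := by
      ext y
      simp only [Finset.mem_filter, Finset.mem_univ, true_and, Finset.mem_singleton]
      constructor
      · rintro rfl
        simp
      · rintro rfl
        simp
    rw [of_apply, this]
    simp

theorem positiveTriangleWithPendants_isTriangleWithPendantsAt {n : ℕ} (hn : 4 ≤ n) :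
    (positiveTriangleWithPendants n).graph.IsTriangleWithPendantsAt
      ⟨0, by omega⟩ ⟨1, by omega⟩ ⟨2, by omega⟩ := by
  refine ⟨by simp, by simp, by simp, fun x y => ?_⟩
  simp only [positiveTriangleWithPendants, SimpleGraph.fromRel_adj, Fin.ext_iff, ne_eq]
  tauto

theorem positiveTriangleWithPendants_adjMatrix (n : ℕ) :
    (positiveTriangleWithPendants n).adjMatrix =
      (positiveTriangleWithPendants n).graph.realAdj := by
  ext i j
  by_cases h : (positiveTriangleWithPendants n).graph.Adj i j
  · rw [adjMatrix_of_adj h, SimpleGraph.realAdj_of_adj h]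
    simp [positiveTriangleWithPendants]
  · rw [adjMatrix_of_not_adj h, SimpleGraph.realAdj_of_not_adj h]

/-- A signed triangle with pendant vertices at one vertex is switching equivalent to the
all-positive one if its triangle is positive. -/
theorem switchingEquivalent_of_positive [Fintype V] {n : ℕ} (hn : 4 ≤ n)
    (hV : Fintype.card V = n) {a b c : V} (h : Γ.graph.IsTriangleWithPendantsAt a b c)
    (hpos : Γ.adjMatrix a b * Γ.adjMatrix b c * Γ.adjMatrix c a = 1) :
    Γ.SwitchingEquivalent (positiveTriangleWithPendants n) := by
  classical
  obtain ⟨f⟩ := h.exists_iso (positiveTriangleWithPendants_isTriangleWithPendantsAt hn)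
    (by simp [hV])
  obtain ⟨hab, hac, hbc, hadj⟩ := h
  -- Switching at the vertices joined negatively to `a` makes every edge at `a` positive. Only `b c`
  -- remains, and its new sign is the product over the triangle.
  let Z : Set V := {y | Γ.adjMatrix a y = -1}
  have haa : Γ.adjMatrix a a = 0 := adjMatrix_of_not_adj (Γ.graph.loopless.irrefl a)
  have hθa : (if a ∈ Z then (-1 : ℝ) else 1) = 1 := by
    simp [Z, haa]
  have hθ : ∀ y, y ≠ a → (if y ∈ Z then (-1 : ℝ) else 1) = Γ.adjMatrix a y := by
    intro y hy
    have hay : Γ.graph.Adj a y := (hadj a y).2 ⟨hy.symm, Or.inl rfl⟩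
    rcases adjMatrix_eq_or hay with e | e
    · simp only [Z, Set.mem_ofPred_eq, e]
      norm_num
    · simp [Z, e]
  have h1 : ∀ y, y ≠ a → (Γ.switch Z).adjMatrix a y = 1 := by
    intro y hy
    have hay : Γ.graph.Adj a y := (hadj a y).2 ⟨hy.symm, Or.inl rfl⟩
    rw [adjMatrix_switch, hθa, hθ y hy]
    rcases adjMatrix_eq_or hay with e | e <;> norm_num [e]
  have h2 : (Γ.switch Z).adjMatrix b c = 1 := by
    rw [adjMatrix_switch, hθ b hab.symm, hθ c hac.symm, adjMatrix_comm a c]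
    exact hpos
  refine ⟨Z, f, fun i j hij => ?_⟩
  refine Eq.trans (b := (1 : ℤˣ)) rfl ?_
  symm
  rw [sign_eq_one_iff]
  rcases (hadj i j).1 hij with ⟨hne, rfl | rfl | ⟨rfl, rfl⟩ | ⟨rfl, rfl⟩⟩
  · exact h1 j hne.symm
  · rw [adjMatrix_comm]
    exact h1 i hne
  · exact h2
  · rw [adjMatrix_comm]
    exact h2

end SignedGraph

/-! ### Proof of the theorem -/

theorem mainTheorem4 {V : Type*} [Fintype V] (n : ℕ) (hn : 4 ≤ n) (hV : Fintype.card V = n)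
    (Γ : SignedGraph V) (hΓ : Γ.IsUnicyclic) :
    Γ.estradaIndex ≤ (SignedGraph.positiveTriangleWithPendants n).estradaIndex ∧
      (Γ.estradaIndex = (SignedGraph.positiveTriangleWithPendants n).estradaIndex ↔
        Γ.SwitchingEquivalent (SignedGraph.positiveTriangleWithPendants n)) := by
  classical
  have hS := SignedGraph.positiveTriangleWithPendants_isTriangleWithPendantsAt hn
  obtain ⟨hle, heq⟩ := SimpleGraph.expTrace_le_of_unicyclic hS (by simp [hV]) hΓ.1 hΓ.2
  have habs : ∀ i j, |Γ.adjMatrix i j| ≤ Γ.graph.realAdj i j :=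
    fun i j => (SignedGraph.abs_adjMatrix i j).le
  have hsign : Γ.adjMatrix.expTrace ≤ Γ.graph.realAdj.expTrace :=
    Matrix.expTrace_le Γ.adjMatrix_isHermitian Γ.graph.realAdj_isHermitian
      fun k => Matrix.trace_pow_le habs k
  refine ⟨?_, fun h => ?_, ?_⟩
  · rw [SignedGraph.estradaIndex_eq_expTrace, SignedGraph.estradaIndex_eq_expTrace,
      SignedGraph.positiveTriangleWithPendants_adjMatrix]
    exact hsign.trans hle
  · rw [SignedGraph.estradaIndex_eq_expTrace, SignedGraph.estradaIndex_eq_expTrace,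
      SignedGraph.positiveTriangleWithPendants_adjMatrix] at h
    -- Equality for the signed graph squeezes the underlying graph between two equal values, so it
    -- is extremal as well.
    obtain ⟨a, b, c, habc⟩ := heq (le_antisymm hle (h ▸ hsign))
    refine SignedGraph.switchingEquivalent_of_positive hn hV habc ?_
    obtain ⟨hab, hac, hbc, -⟩ := habc.isTriangleWithPendants
    by_contra hne
    -- A negative triangle makes the third moment strictly smaller than that of the underlying
    -- graph.
    refine (Matrix.expTrace_lt Γ.adjMatrix_isHermitian Γ.graph.realAdj_isHermitian
      (fun k => Matrix.trace_pow_le habs k)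
      (Matrix.trace_pow_three_lt habs (a := a) (b := b) (c := c) ?_)).not_ge (h ▸ hle)
    rw [SimpleGraph.realAdj_of_adj hab, SimpleGraph.realAdj_of_adj hbc,
      SimpleGraph.realAdj_of_adj hac.symm]
    rcases SignedGraph.adjMatrix_eq_or hab with e1 | e1 <;>
      rcases SignedGraph.adjMatrix_eq_or hbc with e2 | e2 <;>
      rcases SignedGraph.adjMatrix_eq_or hac.symm with e3 | e3 <;>
      rw [e1, e2, e3] at hne ⊢ <;> first | (norm_num; done) | exact absurd (by norm_num) hne
  · rintro ⟨Z, hZ⟩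
    rw [← hZ.estradaIndex_eq, SignedGraph.estradaIndex_switch]
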